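/- Let $K$ be a global field, i.e. either a number field or a finitely generated extension of transcendence degree one of a finite field. Let $S$ be a nonempty finite set of places of $K$ containing all the Archimedean ones, and let $\mathcal{O}_K(S)=\{a\in K : |a|_v\le 1 \text{ for every place } v\notin S\}$. Let $d\geq 0$ be an integer, let $W$ be a finite subset of $\mathrm{GL}_d(\mathcal{O}_K(S))$, let $\alpha>0$, and let $(B_n)_{n\ge 1}$ be subsets of $\mathrm{GL}_d(\mathcal{O}_K(S))$ such that, for every $n\ge 1$, $B_n\subset W^n=W\cdots W$ and $|B_n|\ge e^{\alpha n}$. For a nonzero prime ideal $P$ of $\mathcal{O}_K(S)$ write $|P|=|\mathcal{O}_K(S)/P|$ for its norm and $\pi_P:\mathrm{GL}_d(\mathcal{O}_K(S))\to \mathrm{GL}_d(\mathcal{O}_K(S)/P)$ for reduction modulo $P$. Let $\mathcal{P}_n$ be the set of nonzero prime ideals $P$ of $\mathcal{O}_K(S)$ with $e^{3\alpha n}\le |P|\le e^{4\alpha n}$. Then $\mathcal{P}_n$ is finite for all $n$ and nonempty for all large $n$, and $$\lim_{n\to\infty}\frac{\left|\{P\in\mathcal{P}_n : |\pi_P(B_n)|\ge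 |P|^{1/4}\}\right|}{|\mathcal{P}_n|}=1 .$$ -/

import Mathlib

open Filter Topology

open scoped Pointwise

/-- A global field: a number field, or a finitely generated extension of transcendence degree one
of a finite field (the finite field being realised as a subfield). -/
def IsGlobalField (K : Type*) [Field K] : Prop :=
  NumberField K ∨
    ∃ k : Subfield K, Finite k ∧ (⊤ : IntermediateField k K).FG ∧ Algebra.trdeg k K = 1

/-- Equivalence of nontrivial real-valued absolute values (they induce the same topology). -/
def Place.setoid (K : Type*) [Field K] : Setoid {v : AbsoluteValue K ℝ // v.IsNontrivial} where
  r v w := v.1.IsEquiv w.1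
  iseqv := ⟨fun _ => AbsoluteValue.IsEquiv.rfl, fun h => h.symm, fun h h' => h.trans h'⟩

/-- A place of `K`: an equivalence class of nontrivial absolute values on `K`. -/
def Place (K : Type*) [Field K] : Type _ := Quotient (Place.setoid K)

namespace Place

variable {K : Type*} [Field K]

/-- `v.LeOne a` means `|a|_v ≤ 1`, for any absolute value representing the place `v`. -/
def LeOne (v : Place K) (a : K) : Prop :=
  Quotient.lift (fun w : {w : AbsoluteValue K ℝ // w.IsNontrivial} => w.1 a ≤ 1)
    (fun _ _ h => propext (AbsoluteValue.IsEquiv.le_one_iff h)) v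

theorem isNonarchimedean_of_isEquiv {v w : AbsoluteValue K ℝ} (h : v.IsEquiv w)
    (hv : IsNonarchimedean v) : IsNonarchimedean w := fun a b =>
  le_max_iff.2 ((le_max_iff.1 (hv a b)).imp h.le_iff_le.1 h.le_iff_le.1)

/-- A place is Archimedean if its absolute values violate the ultrametric inequality. -/
def IsArchimedean (v : Place K) : Prop :=
  Quotient.lift (fun w : {w : AbsoluteValue K ℝ // w.IsNontrivial} => ¬ IsNonarchimedean w.1)
    (fun _ _ h => propext (not_congr ⟨isNonarchimedean_of_isEquiv h,
      isNonarchimedean_of_isEquiv (AbsoluteValue.IsEquiv.symm h)⟩)) v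

end Place

/-- The ring of `S`-integers `{a ∈ K : |a|_v ≤ 1 for all v ∉ S}`, for a set `S` of places that
contains all the Archimedean ones. -/
def SIntegers {K : Type*} [Field K] (S : Set (Place K))
    (hS : ∀ v : Place K, v.IsArchimedean → v ∈ S) : Subring K where
  carrier := {a | ∀ v : Place K, v ∉ S → v.LeOne a}
  mul_mem' {a b} ha hb v hv := by
    have ha' := ha v hv
    have hb' := hb v hv
    clear ha hb hv
    induction v using Quotient.inductionOn with
    | h w => 
      change w.1 a ≤ 1 at ha'
      change w.1 b ≤ 1 at hb'
      change w.1 (a * b) ≤ 1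
      rw [map_mul]
      exact mul_le_one₀ ha' (w.1.nonneg b) hb'
  one_mem' v _ := by
    induction v using Quotient.inductionOn with
    | h w => exact (map_one w.1).le
  add_mem' {a b} ha hb v hv := by
    have ha' := ha v hv
    have hb' := hb v hv
    have hna : ¬ v.IsArchimedean := fun h => hv (hS v h)
    clear ha hb hv
    induction v using Quotient.inductionOn with
    | h w => 
      change w.1 a ≤ 1 at ha'
      change w.1 b ≤ 1 at hb'
      change ¬ ¬ IsNonarchimedean w.1 at hna
      change w.1 (a + b) ≤ 1
      exact (not_not.1 hna a b).trans (max_le ha' hb')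
  zero_mem' v _ := by
    induction v using Quotient.inductionOn with
    | h w => exact (map_zero w.1).le.trans zero_le_one
  neg_mem' {a} ha v hv := by
    have ha' := ha v hv
    clear ha hv
    induction v using Quotient.inductionOn with
    | h w => 
      change w.1 a ≤ 1 at ha'
      change w.1 (-a) ≤ 1
      rwa [AbsoluteValue.map_neg]

/-- The norm `|P|` of an ideal: the size of the residue ring `R ⧸ P`. -/
noncomputable def primeNorm {R : Type*} [CommRing R] (P : Ideal R) : ℕ := Nat.card (R ⧸ P)

/-- The reduction map `π_P : GL_d(R) → GL_d(R ⧸ P)`. -/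
def reductionMod {R : Type*} [CommRing R] (d : ℕ) (P : Ideal R) :
    Matrix.GeneralLinearGroup (Fin d) R →* Matrix.GeneralLinearGroup (Fin d) (R ⧸ P) :=
  Matrix.GeneralLinearGroup.map (Ideal.Quotient.mk P)

/-- The nonzero prime ideals of `R` whose norm lies in the interval `[x, y]`. -/
def primesInInterval (R : Type*) [CommRing R] (x y : ℝ) : Set (Ideal R) :=
  {P | P.IsPrime ∧ P ≠ ⊥ ∧ x ≤ (primeNorm P : ℝ) ∧ (primeNorm P : ℝ) ≤ y}

/-! Call a prime P of `primesInInterval` bad for n if B_n has fewer than |P|^(1/4) ≤ e^(αn) residues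
modulo P. Fix N = ⌈e^(αn)⌉ elements of B_n. By pigeonhole two of them agree modulo a bad P, so P
contains a chosen nonzero entry of their difference. Entries of elements of W^n have a common
denominator t^n and numerators of size exponential in n, so such an entry has norm e^(O(n)) after
clearing denominators and lies in O(1) primes of norm at least e^(3αn). Summing over the O(e^(2αn))
pairs gives O(e^(2αn)) bad primes (`exists_ncard_bad_le`). It remains to see that the interval
contains at least a constant times e^(3αn) primes; the bad ones then have proportion O(e^(-αn)).

With x = e^(4αn) this asks for c·x^(3/4) primes of norm in [x^(3/4), x], far less than the prime
ideal theorem. Chebyshev's method suffices (`exists_le_ncard_primesInInterval`). Take a family of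
ideals of norm at most x, mostly of norm nearly x, in which about 1/|Q| of the members are divisible
by Q (`EquidistributedIdeals`). Factoring every member bounds the sum of log|P|/|P|^k first, and
then shows that prime powers of norm at most x^(3/4) account for too little of the total logarithm;
the larger ones must be numerous, and proper powers among them are negligible.

All this takes place in a Dedekind domain A inside the S-integers R with fraction field K. Nonzero
primes of R contract injectively to A with the same residue ring, and all but finitely many primes
of A arise so.

For a number field, A is the ring of integers and the family is all nonzero ideals of norm at most
x, counted by the residue of the Dedekind zeta function. For a function field over k, exponential
growth forces R to contain an element transcendental over k, hence a separating element z, and A is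
the integral closure of k[z]. It is free over k[X], and the family consists of the principal ideals
of elements with coordinates of degree < n. Divisibility by Q cuts out a subspace whose dimension is
given by a weak Riemann–Roch statement (`finrank_degreeBox_inf_eq`); a counting argument with
characteristic polynomials shows that most of these elements have nearly maximal norm. -/

set_option linter.unusedSectionVars false

/-! ### Norms of ideals and Chebyshev's identity -/

section IdealNorm

open Submodule UniqueFactorizationMonoid

variable {A : Type*} [CommRing A] [IsDedekindDomain A]

/-- Infiniteness gives the zero ideal norm 0, so the identity needs no nonvanishing assumption.
Otherwise it reduces to prime powers and the Chinese remainder theorem. -/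
theorem cardQuot_mul_of_infinite [Infinite A] (I J : Ideal A) :
    cardQuot (I * J) = cardQuot I * cardQuot J :=
  UniqueFactorizationMonoid.multiplicative_of_coprime cardQuot I J (cardQuot_bot _ _)
    (fun {I J} hI => by simp [Ideal.isUnit_iff.mp hI, Ideal.mul_top])
    (fun {I} i hI =>
      have : Ideal.IsPrime I := Ideal.isPrime_of_prime hI
      cardQuot_pow_of_prime hI.ne_zero)
    fun {I J} hIJ => cardQuot_mul_of_coprime <| Ideal.isCoprime_iff_sup_eq.mpr
      (Ideal.isUnit_iff.mp
        (hIJ (Ideal.dvd_iff_le.mpr le_sup_left) (Ideal.dvd_iff_le.mpr le_sup_right)))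

/-- The ideal norm `I ↦ |A ⧸ I|` of an infinite Dedekind domain as a monoid homomorphism. -/
noncomputable def cardQuotHom (A : Type*) [CommRing A] [IsDedekindDomain A] [Infinite A] :
    Ideal A →*₀ ℕ where
  toFun := cardQuot
  map_mul' := cardQuot_mul_of_infinite
  map_one' := by rw [Ideal.one_eq_top, cardQuot_top]
  map_zero' := by rw [Ideal.zero_eq_bot, cardQuot_bot]

theorem cardQuotHom_apply [Infinite A] (I : Ideal A) : cardQuotHom A I = cardQuot I := rfl

variable [Ring.HasFiniteQuotients A]

theorem two_le_cardQuot {P : Ideal A} (hP : P.IsPrime) (h0 : P ≠ ⊥) : 2 ≤ cardQuot P := by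
  have h1 := Ring.HasFiniteQuotients.cardQuot_pos P h0
  have h2 : cardQuot P ≠ 1 := fun h => hP.ne_top (cardQuot_eq_one_iff.1 h)
  omega

theorem cardQuot_le_of_dvd [Infinite A] {I J : Ideal A} (hJ : J ≠ ⊥) (h : I ∣ J) :
    cardQuot I ≤ cardQuot J :=
  Nat.le_of_dvd (Ring.HasFiniteQuotients.cardQuot_pos J hJ) (map_dvd (cardQuotHom A) h)

/-- The pairs `(P, k)` with `P` a nonzero prime, `1 ≤ k` and `|P| ^ k ≤ x`. -/
def primePowersLE (A : Type*) [CommRing A] (x : ℝ) : Set (Ideal A × ℕ) :=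
  {q | q.1.IsPrime ∧ q.1 ≠ ⊥ ∧ 1 ≤ q.2 ∧ ((cardQuot q.1 : ℝ)) ^ q.2 ≤ x}

theorem finite_cardQuot_le_real (x : ℝ) : {I : Ideal A | (cardQuot I : ℝ) ≤ x}.Finite := by
  refine (Ring.HasFiniteQuotients.finite_cardQuot_le (R := A) ⌊x⌋₊).subset fun I hI => ?_
  exact Nat.le_floor hI

theorem cardQuot_le_pow {P : Ideal A} (hP : P.IsPrime) (h0 : P ≠ ⊥) {k : ℕ} (hk : 1 ≤ k) :
    (cardQuot P : ℝ) ≤ (cardQuot P : ℝ) ^ k :=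
  le_self_pow₀ (by exact_mod_cast (one_le_two.trans (two_le_cardQuot hP h0))) (by omega)

theorem exponent_le_log {P : Ideal A} (hP : P.IsPrime) (h0 : P ≠ ⊥) {k : ℕ} {x : ℝ}
    (hk : (cardQuot P : ℝ) ^ k ≤ x) : (k : ℝ) ≤ Real.log x / Real.log 2 := by
  have h2 : (2 : ℝ) ≤ cardQuot P := by exact_mod_cast two_le_cardQuot hP h0
  rw [le_div_iff₀ (Real.log_pos one_lt_two), ← Real.log_pow]
  exact Real.log_le_log (by positivity) ((pow_le_pow_left₀ (by norm_num) h2 k).trans hk)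

theorem primePowersLE_finite (x : ℝ) : (primePowersLE A x).Finite := by
  refine ((finite_cardQuot_le_real (A := A) x).prod
    (Set.finite_Iic ⌊Real.log x / Real.log 2⌋₊)).subset ?_
  rintro ⟨P, k⟩ ⟨hP, h0, hk, hx⟩
  exact ⟨(cardQuot_le_pow hP h0 hk).trans hx, Nat.le_floor (exponent_le_log hP h0 hx)⟩

/-- `primePowersLE` as a finset. -/
noncomputable def primePowers (A : Type*) [CommRing A] [IsDedekindDomain A]
    [Ring.HasFiniteQuotients A] (x : ℝ) : Finset (Ideal A × ℕ) :=
  (primePowersLE_finite (A := A) x).toFinset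

theorem mem_primePowers {x : ℝ} {q : Ideal A × ℕ} : q ∈ primePowers A x ↔
    q.1.IsPrime ∧ q.1 ≠ ⊥ ∧ 1 ≤ q.2 ∧ ((cardQuot q.1 : ℝ)) ^ q.2 ≤ x :=
  Set.Finite.mem_toFinset _

theorem primePowers_mono {x y : ℝ} (h : x ≤ y) : primePowers A x ⊆ primePowers A y :=
  fun q hq => by
    rw [mem_primePowers] at hq ⊢
    exact ⟨hq.1, hq.2.1, hq.2.2.1, hq.2.2.2.trans h⟩

theorem cardQuot_pow_eq [Infinite A] (P : Ideal A) (k : ℕ) :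
    cardQuot (P ^ k) = cardQuot P ^ k := map_pow (cardQuotHom A) P k

open Classical in
/-- Chebyshev's identity: `log |I|` is the sum of `log |P|` over the prime powers dividing `I`. -/
theorem log_cardQuot_eq_sum [Infinite A] {I : Ideal A} (hI : I ≠ ⊥) {x : ℝ}
    (hx : (cardQuot I : ℝ) ≤ x) :
    Real.log (cardQuot I) = ∑ q ∈ primePowers A x with q.1 ^ q.2 ∣ I, Real.log (cardQuot q.1) := by
  set F := normalizedFactors I with hF
  have hpp : ∀ P ∈ F, P.IsPrime ∧ P ≠ ⊥ := fun P hP =>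
    ⟨Ideal.isPrime_of_prime (prime_of_normalized_factor P hP),
      (prime_of_normalized_factor P hP).ne_zero⟩
  have hprod : F.prod = I := by
    have := prod_normalizedFactors (a := I) (by simpa using hI)
    exact associated_iff_eq.1 this
  have hdvd : ∀ P : Ideal A, P.IsPrime → P ≠ ⊥ → ∀ k, P ^ k ∣ I ↔ k ≤ F.count P := by
    intro P hP h0 k
    have hirr : Irreducible P := (Ideal.prime_of_isPrime h0 hP).irreducible
    rw [pow_dvd_iff_le_emultiplicity, emultiplicity_eq_count_normalizedFactors hirr
      (by simpa using hI), normalize_eq]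
    exact Nat.cast_le
  have h1 : Real.log (cardQuot I) = (F.map fun P => Real.log (cardQuot P)).sum := by
    have : ∀ G : Multiset (Ideal A), (∀ P ∈ G, P ≠ ⊥) →
        Real.log (cardQuot G.prod) = (G.map fun P => Real.log (cardQuot P)).sum := by
      intro G
      induction G using Multiset.induction_on with
      | empty => intro _; simp [Ideal.one_eq_top]
      | cons P G ih =>
        intro h
        have hG : G.prod ≠ ⊥ := by
          intro h'
          have : (0 : Ideal A) ∈ G := Multiset.prod_eq_zero_iff.1 h'
          exact h 0 (Multiset.mem_cons_of_mem this) rfl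
        have p1 := Ring.HasFiniteQuotients.cardQuot_pos _ hG
        have p2 := Ring.HasFiniteQuotients.cardQuot_pos _ (h P (Multiset.mem_cons_self _ _))
        rw [Multiset.prod_cons, cardQuot_mul_of_infinite, Nat.cast_mul,
          Real.log_mul (by positivity) (by positivity), Multiset.map_cons, Multiset.sum_cons,
          ih fun P hP => h P (Multiset.mem_cons_of_mem hP)]
    rw [← this F fun P hP => (hpp P hP).2, hprod]
  rw [h1, Finset.sum_multiset_map_count]
  -- The prime powers dividing I are the pairs (P, k) with 1 ≤ k ≤ v_P(I), so each P is counted with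
  -- its multiplicity. The cutoff x loses none, since a divisor of I has norm at most |I|.
  have h2 : (primePowers A x).filter (fun q => q.1 ^ q.2 ∣ I) =
      F.toFinset.biUnion fun P => (Finset.Icc 1 (F.count P)).image fun k => (P, k) := by
    ext ⟨P, k⟩
    simp only [Finset.mem_filter, mem_primePowers, Finset.mem_biUnion, Multiset.mem_toFinset,
      Finset.mem_image, Finset.mem_Icc, Prod.mk.injEq]
    constructor
    · rintro ⟨⟨hP, h0, hk, -⟩, hd⟩
      have hc := (hdvd P hP h0 k).1 hd
      exact ⟨P, Multiset.count_pos.1 (by omega), k, ⟨hk, hc⟩, rfl, rfl⟩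
    · rintro ⟨P', hP', k', ⟨hk, hc⟩, rfl, rfl⟩
      obtain ⟨hp, h0⟩ := hpp _ hP'
      have hd := (hdvd P' hp h0 k').2 hc
      refine ⟨⟨hp, h0, hk, le_trans ?_ hx⟩, hd⟩
      rw [← Nat.cast_pow, ← cardQuot_pow_eq]
      exact_mod_cast cardQuot_le_of_dvd hI hd
  rw [h2, Finset.sum_biUnion]
  · refine Finset.sum_congr rfl fun P _ => ?_
    rw [Finset.sum_image (by simp)]
    simp
  · intro P _ P' _ hne
    rw [Function.onFun, Finset.disjoint_left]
    intro q hq hq'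
    simp only [Finset.mem_image] at hq hq'
    obtain ⟨k, -, rfl⟩ := hq
    obtain ⟨k', -, h⟩ := hq'
    exact hne (Prod.mk.inj h).1.symm

end IdealNorm

/-! ### Chebyshev's lower bound for primes from equidistribution -/

section PrimeCount

open Submodule

universe u

open Classical in
/-- There are, for all large `x`, finite families of nonzero ideals of norm at most `x`, most of
them of norm not much smaller than `x`, which are equidistributed modulo ideals. -/
def EquidistributedIdeals (A : Type u) [CommRing A] : Prop :=
  ∃ C : ℝ, ∀ᶠ x : ℝ in atTop, ∃ (ι : Type u) (s : Finset ι) (g : ι → Ideal A),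
    s.Nonempty ∧ (∀ i ∈ s, g i ≠ ⊥ ∧ (cardQuot (g i) : ℝ) ≤ x) ∧
    19 / 20 * Real.log x * s.card ≤ ∑ i ∈ s, Real.log (cardQuot (g i)) ∧
    ∀ Q : Ideal A, Q ≠ ⊥ →
      ((cardQuot Q : ℝ) ≤ x ^ (19 / 20 : ℝ) →
        19 / 20 * (s.card : ℝ) ≤ cardQuot Q * ((s.filter fun i => Q ∣ g i).card : ℝ)) ∧
      ((cardQuot Q : ℝ) ≤ x ^ (3 / 4 : ℝ) →
        cardQuot Q * ((s.filter fun i => Q ∣ g i).card : ℝ) ≤ 21 / 20 * (s.card : ℝ)) ∧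
      (x ^ (3 / 4 : ℝ) ≤ (cardQuot Q : ℝ) →
        x ^ (3 / 4 : ℝ) * ((s.filter fun i => Q ∣ g i).card : ℝ) ≤ C * (s.card : ℝ))

variable {A : Type u} [CommRing A] [IsDedekindDomain A] [Ring.HasFiniteQuotients A] [Infinite A]

/-- The Mertens sum of `log |P| / |P| ^ k` over the prime powers `P ^ k` of norm at most `x`. -/
noncomputable def mertensSum (A : Type u) [CommRing A] [IsDedekindDomain A]
    [Ring.HasFiniteQuotients A] (x : ℝ) : ℝ :=
  ∑ q ∈ primePowers A x, Real.log (cardQuot q.1) / (cardQuot q.1 : ℝ) ^ q.2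

open Classical in
-- Chebyshev's identity summed over the family, with the two sums exchanged.
theorem sum_log_cardQuot_eq {ι : Type u} (s : Finset ι) (g : ι → Ideal A) {x : ℝ}
    (hg : ∀ i ∈ s, g i ≠ ⊥ ∧ (cardQuot (g i) : ℝ) ≤ x) :
    ∑ i ∈ s, Real.log (cardQuot (g i)) = ∑ q ∈ primePowers A x,
      Real.log (cardQuot q.1) * ((s.filter fun i => q.1 ^ q.2 ∣ g i).card : ℝ) := by
  rw [Finset.sum_congr rfl fun i hi => log_cardQuot_eq_sum (hg i hi).1 (hg i hi).2]
  simp_rw [Finset.sum_filter]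
  rw [Finset.sum_comm]
  refine Finset.sum_congr rfl fun q _ => ?_
  rw [← Finset.sum_filter, Finset.sum_const, nsmul_eq_mul, mul_comm]

theorem log_cardQuot_nonneg (P : Ideal A) : 0 ≤ Real.log (cardQuot P) :=
  Real.log_natCast_nonneg _

theorem pow_ne_bot_of_mem_primePowers {x : ℝ} {q : Ideal A × ℕ} (hq : q ∈ primePowers A x) :
    q.1 ^ q.2 ≠ ⊥ := pow_ne_zero _ (mem_primePowers.1 hq).2.1

/-- The average of log|g i| is at most log x, while each prime power of norm up to x^(19/20)
contributes at least 19/20 of its expected share to that average. -/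
theorem mertensSum_rpow_le (h : EquidistributedIdeals A) :
    ∀ᶠ x : ℝ in atTop, mertensSum A (x ^ (19 / 20 : ℝ)) ≤ 20 / 19 * Real.log x := by
  classical
  obtain ⟨C, h⟩ := h
  filter_upwards [h, eventually_ge_atTop 1] with x ⟨ι, s, g, hs, hg, _, hQ⟩ hx
  have hs0 : (0 : ℝ) < s.card := by exact_mod_cast hs.card_pos
  have h1 : ∑ i ∈ s, Real.log (cardQuot (g i)) ≤ s.card * Real.log x := by
    rw [← nsmul_eq_mul]
    refine Finset.sum_le_card_nsmul _ _ _ fun i hi => ?_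
    have := Ring.HasFiniteQuotients.cardQuot_pos _ (hg i hi).1
    exact Real.log_le_log (by positivity) (hg i hi).2
  have h2 : 19 / 20 * (s.card : ℝ) * mertensSum A (x ^ (19 / 20 : ℝ)) ≤
      ∑ i ∈ s, Real.log (cardQuot (g i)) := by
    rw [sum_log_cardQuot_eq s g hg, mertensSum, Finset.mul_sum]
    have hsub : primePowers A (x ^ (19 / 20 : ℝ)) ⊆ primePowers A x :=
      primePowers_mono ((Real.rpow_le_rpow_of_exponent_le hx (by norm_num)).trans_eq
        (Real.rpow_one x))
    refine (Finset.sum_le_sum fun q hq => ?_).trans (Finset.sum_le_sum_of_subset_of_nonneg hsub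
      fun q _ _ => mul_nonneg (log_cardQuot_nonneg _) (Nat.cast_nonneg _))
    have hb := pow_ne_bot_of_mem_primePowers hq
    have hq' := (hQ _ hb).1 (by
      rw [cardQuot_pow_eq, Nat.cast_pow]; exact (mem_primePowers.1 hq).2.2.2)
    rw [cardQuot_pow_eq, Nat.cast_pow] at hq'
    have hpos : (0 : ℝ) < (cardQuot q.1 : ℝ) ^ q.2 := by
      have := Ring.HasFiniteQuotients.cardQuot_pos _ (mem_primePowers.1 hq).2.1
      positivity
    rw [mul_div_assoc', div_le_iff₀ hpos]
    nlinarith [mul_le_mul_of_nonneg_left hq' (log_cardQuot_nonneg q.1)]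
  have h3 := h2.trans h1
  have : (s.card : ℝ) * (19 / 20 * mertensSum A (x ^ (19 / 20 : ℝ))) ≤ s.card * Real.log x := by
    linarith
  have := le_of_mul_le_mul_left this hs0
  linarith

theorem mertensSum_le (h : EquidistributedIdeals A) :
    ∀ᶠ x : ℝ in atTop, mertensSum A x ≤ (20 / 19) ^ 2 * Real.log x := by
  have h1 := (tendsto_rpow_atTop (show (0 : ℝ) < 20 / 19 by norm_num)).eventually
    (mertensSum_rpow_le h)
  filter_upwards [h1, eventually_gt_atTop 0] with x hx hx0
  rw [← Real.rpow_mul hx0.le, Real.log_rpow hx0] at hx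
  norm_num at hx ⊢
  linarith

/-- The number of prime powers of norm in `(x ^ (3 / 4), x]` is at least `c * x ^ (3 / 4)`. -/
theorem exists_le_card_primePowers_sdiff (h : EquidistributedIdeals A) :
    ∃ c : ℝ, 0 < c ∧ ∀ᶠ x : ℝ in atTop, c * x ^ (3 / 4 : ℝ) ≤
      ((primePowers A x).filter fun q => ¬ q ∈ primePowers A (x ^ (3 / 4 : ℝ))).card := by
  classical
  have hM := (tendsto_rpow_atTop (show (0 : ℝ) < 3 / 4 by norm_num)).eventually (mertensSum_le h)
  obtain ⟨C, h⟩ := h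
  -- The total is at least 19/20 · log x per member; prime powers up to x^(3/4) supply at most 21/20
  -- · (20/19)² · 3/4 · log x. The difference exceeds 7/100 · log x and falls to the larger ones,
  -- each supplying at most log x · C / x^(3/4).
  refine ⟨7 / 100 / max C 1, by positivity, ?_⟩
  filter_upwards [h, hM, eventually_gt_atTop 1] with x ⟨ι, s, g, hs, hg, hlog, hQ⟩ hM hx
  have hx0 : 0 < x := by linarith
  have hs0 : (0 : ℝ) < s.card := by exact_mod_cast hs.card_pos
  have hlx : 0 < Real.log x := Real.log_pos hx
  set y := x ^ (3 / 4 : ℝ) with hy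
  have hy0 : 0 < y := by positivity
  rw [Real.log_rpow hx0] at hM
  have hyx : y ≤ x :=
    (Real.rpow_le_rpow_of_exponent_le hx.le (by norm_num)).trans_eq (Real.rpow_one x)
  set T := (primePowers A x).filter fun q => ¬ q ∈ primePowers A y with hT
  rw [sum_log_cardQuot_eq s g hg,
    ← Finset.sum_filter_add_sum_filter_not _ (· ∈ primePowers A y)] at hlog
  have hfil : (primePowers A x).filter (· ∈ primePowers A y) = primePowers A y := by
    rw [Finset.filter_mem_eq_inter, Finset.inter_eq_right]
    exact primePowers_mono hyx
  rw [hfil] at hlog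
  have hsmall : ∑ q ∈ primePowers A y, Real.log (cardQuot q.1) *
      ((s.filter fun i => q.1 ^ q.2 ∣ g i).card : ℝ) ≤ 21 / 20 * s.card * mertensSum A y := by
    rw [mertensSum, Finset.mul_sum]
    refine Finset.sum_le_sum fun q hq => ?_
    have hq' := (hQ _ (pow_ne_bot_of_mem_primePowers hq)).2.1 (by
      rw [cardQuot_pow_eq, Nat.cast_pow]; exact (mem_primePowers.1 hq).2.2.2)
    rw [cardQuot_pow_eq, Nat.cast_pow] at hq'
    have hpos : (0 : ℝ) < (cardQuot q.1 : ℝ) ^ q.2 := by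
      have := Ring.HasFiniteQuotients.cardQuot_pos _ (mem_primePowers.1 hq).2.1
      positivity
    rw [mul_div_assoc', le_div_iff₀ hpos]
    nlinarith [mul_le_mul_of_nonneg_left hq' (log_cardQuot_nonneg q.1)]
  have hlarge : ∑ q ∈ T, Real.log (cardQuot q.1) *
      ((s.filter fun i => q.1 ^ q.2 ∣ g i).card : ℝ) ≤
        T.card * (Real.log x * (max C 1 * s.card / y)) := by
    rw [← nsmul_eq_mul]
    refine Finset.sum_le_card_nsmul _ _ _ fun q hq => ?_
    rw [hT, Finset.mem_filter] at hq
    obtain ⟨hq1, hq2⟩ := hq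
    have hm := mem_primePowers.1 hq1
    have hpos := Ring.HasFiniteQuotients.cardQuot_pos _ hm.2.1
    have hq' := (hQ _ (pow_ne_bot_of_mem_primePowers hq1)).2.2 (by
      rw [cardQuot_pow_eq, Nat.cast_pow]
      by_contra! hlt
      exact hq2 (mem_primePowers.2 ⟨hm.1, hm.2.1, hm.2.2.1, hlt.le⟩))
    refine mul_le_mul (Real.log_le_log (by positivity)
      ((cardQuot_le_pow hm.1 hm.2.1 hm.2.2.1).trans hm.2.2.2)) ?_ (Nat.cast_nonneg _) hlx.le
    rw [le_div_iff₀ hy0, mul_comm]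
    exact hq'.trans (mul_le_mul_of_nonneg_right (le_max_left _ _) hs0.le)
  have hm := mul_le_mul_of_nonneg_left hM (show 0 ≤ 21 / 20 * (s.card : ℝ) by positivity)
  have key : 7 / 100 * (Real.log x * s.card) ≤
      (T.card * max C 1 / y) * (Real.log x * s.card) := by
    have e : (T.card : ℝ) * (Real.log x * (max C 1 * s.card / y)) =
      (T.card * max C 1 / y) * (Real.log x * s.card) := by ring
    rw [← e]
    have hpos : 0 < Real.log x * s.card := by positivity
    nlinarith
  have key2 := le_of_mul_le_mul_right key (by positivity)
  rw [le_div_iff₀ hy0] at key2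
  rw [div_mul_eq_mul_div, div_le_iff₀ (by positivity)]
  exact key2

/-- Each prime of norm at most x contributes at least log 2 / x to the Mertens sum. -/
theorem card_primes_le_mertensSum {x : ℝ} (hx : 1 ≤ x) :
    (((primePowers A x).filter fun q => q.2 = 1).card : ℝ) * Real.log 2 ≤ x * mertensSum A x := by
  have h1 : (((primePowers A x).filter fun q => q.2 = 1).card : ℝ) * (Real.log 2 / x) ≤
      mertensSum A x := by
    rw [← nsmul_eq_mul]
    refine (Finset.card_nsmul_le_sum _ (fun q : Ideal A × ℕ => Real.log (cardQuot q.1) /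
      (cardQuot q.1 : ℝ) ^ q.2) _ fun q hq => ?_).trans
      (Finset.sum_le_sum_of_subset_of_nonneg (Finset.filter_subset _ _) fun q _ _ =>
        div_nonneg (log_cardQuot_nonneg _) (by positivity))
    rw [Finset.mem_filter] at hq
    have hm := mem_primePowers.1 hq.1
    have h2 : (2 : ℝ) ≤ cardQuot q.1 := by exact_mod_cast two_le_cardQuot hm.1 hm.2.1
    exact div_le_div₀ (log_cardQuot_nonneg _) (Real.log_le_log (by norm_num) h2) (by positivity)
      hm.2.2.2
  have h2 := mul_le_mul_of_nonneg_left h1 (show 0 ≤ x by linarith)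
  have : x * ((((primePowers A x).filter fun q => q.2 = 1).card : ℝ) * (Real.log 2 / x)) =
      (((primePowers A x).filter fun q => q.2 = 1).card : ℝ) * Real.log 2 := by
    field_simp
  linarith

/-- A proper power of norm at most x has base of norm at most √x and exponent at most log₂ x. -/
theorem card_proper_primePowers_le {x : ℝ} (hx : 1 ≤ x) :
    (((primePowers A x).filter fun q => q.2 ≠ 1).card : ℝ) ≤
      ((primePowers A (x ^ (1 / 2 : ℝ))).filter fun q => q.2 = 1).card *
        (Real.log x / Real.log 2) := by
  classical
  have hlog : 0 ≤ Real.log x / Real.log 2 :=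
    div_nonneg (Real.log_nonneg hx) (Real.log_pos one_lt_two).le
  set K := Finset.Icc 1 ⌊Real.log x / Real.log 2⌋₊ with hK
  have hKc : (K.card : ℝ) ≤ Real.log x / Real.log 2 := by
    rw [hK, Nat.card_Icc]; exact (Nat.floor_le hlog)
  have hsub : (primePowers A x).filter (fun q => q.2 ≠ 1) ⊆
      (((primePowers A (x ^ (1 / 2 : ℝ))).filter fun q => q.2 = 1) ×ˢ K).image
        fun r => (r.1.1, r.2) := by
    rintro ⟨P, k⟩ hq
    rw [Finset.mem_filter] at hq
    obtain ⟨hq, hk1⟩ := hq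
    obtain ⟨hP, h0, hk, hle⟩ := mem_primePowers.1 hq
    dsimp only at hP h0 hk hle hk1
    have h2 : (1 : ℝ) ≤ cardQuot P := by
      exact_mod_cast one_le_two.trans (two_le_cardQuot hP h0)
    refine Finset.mem_image.2 ⟨((P, 1), k), ?_, rfl⟩
    refine Finset.mem_product.2 ⟨Finset.mem_filter.2 ⟨mem_primePowers.2
      ⟨hP, h0, le_rfl, ?_⟩, rfl⟩, Finset.mem_Icc.2 ⟨hk, Nat.le_floor (exponent_le_log hP h0 hle)⟩⟩
    rw [pow_one, ← Real.sqrt_eq_rpow]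
    refine Real.le_sqrt_of_sq_le ((pow_le_pow_right₀ h2 ?_).trans hle)
    omega
  have h1 := (Finset.card_le_card hsub).trans Finset.card_image_le
  rw [Finset.card_product] at h1
  calc (((primePowers A x).filter fun q => q.2 ≠ 1).card : ℝ)
      ≤ ((primePowers A (x ^ (1 / 2 : ℝ))).filter fun q => q.2 = 1).card * (K.card : ℝ) := by
        exact_mod_cast h1
    _ ≤ _ := mul_le_mul_of_nonneg_left hKc (Nat.cast_nonneg _)

theorem primesInInterval_finite (x y : ℝ) : (primesInInterval A x y).Finite :=
  (finite_cardQuot_le_real (A := A) y).subset fun _ hP => hP.2.2.2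

/-- A weak form of the prime ideal theorem. -/
theorem exists_le_ncard_primesInInterval (h : EquidistributedIdeals A) :
    ∃ c : ℝ, 0 < c ∧ ∀ᶠ x : ℝ in atTop, c * x ^ (3 / 4 : ℝ) ≤
      ((primesInInterval A (x ^ (3 / 4 : ℝ)) x).ncard : ℝ) := by
  classical
  have hM := (tendsto_rpow_atTop (show (0 : ℝ) < 1 / 2 by norm_num)).eventually (mertensSum_le h)
  obtain ⟨c, hc, h⟩ := exists_le_card_primePowers_sdiff h
  refine ⟨c / 2, by positivity, ?_⟩
  -- The two preceding estimates bound the proper powers by O(x^(1/2) log² x), which costs at most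
  -- half of the constant c.
  have hsmall : ∀ᶠ x : ℝ in atTop,
      x ^ (1 / 2 : ℝ) * Real.log x ^ (2 : ℝ) * 2 ≤ c / 2 * x ^ (3 / 4 : ℝ) := by
    have ho := (isLittleO_log_rpow_rpow_atTop (2 : ℝ) (show (0 : ℝ) < 1 / 4 by norm_num)).bound
      (show 0 < c / 4 by positivity)
    filter_upwards [ho, eventually_gt_atTop 1] with x hx hx1
    have hl : 0 ≤ Real.log x ^ (2 : ℝ) := Real.rpow_nonneg (Real.log_nonneg hx1.le) _
    rw [Real.norm_of_nonneg hl, Real.norm_of_nonneg (by positivity)] at hx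
    have e : x ^ (3 / 4 : ℝ) = x ^ (1 / 2 : ℝ) * x ^ (1 / 4 : ℝ) := by
      rw [← Real.rpow_add (by linarith)]; norm_num
    rw [e]
    have : 0 < x ^ (1 / 2 : ℝ) := by positivity
    nlinarith
  filter_upwards [h, hM, hsmall, eventually_gt_atTop 1] with x h hM hsmall hx
  have hx0 : 0 < x := by linarith
  set y := x ^ (3 / 4 : ℝ) with hy
  set T := (primePowers A x).filter fun q => ¬ q ∈ primePowers A y with hT
  have hT1 : T.card = (T.filter fun q => q.2 = 1).card + (T.filter fun q => q.2 ≠ 1).card :=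
    (Finset.card_filter_add_card_filter_not _).symm
  have h1 : (T.filter fun q => q.2 = 1).card ≤ (primesInInterval A y x).ncard := by
    rw [← Set.ncard_coe_finset]
    refine Set.ncard_le_ncard_of_injOn (fun q => q.1) ?_ ?_ (primesInInterval_finite y x)
    · rintro ⟨P, k⟩ hq
      simp only [hT, Finset.coe_filter, Finset.mem_filter, Set.mem_ofPred_eq] at hq
      obtain ⟨⟨hq1, hq2⟩, rfl⟩ := hq
      obtain ⟨hP, h0, hk, hle⟩ := mem_primePowers.1 hq1
      simp only [pow_one] at hle
      refine ⟨hP, h0, ?_, hle⟩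
      by_contra! hlt
      exact hq2 (mem_primePowers.2 ⟨hP, h0, hk, (pow_one _).trans_le hlt.le⟩)
    · rintro ⟨P, k⟩ hq ⟨P', k'⟩ hq' hPP
      simp only [Finset.coe_filter, Set.mem_ofPred_eq] at hq hq'
      exact Prod.ext hPP (hq.2.trans hq'.2.symm)
  have h2 : (T.filter fun q => q.2 ≠ 1).card ≤
      ((primePowers A x).filter fun q => q.2 ≠ 1).card :=
    Finset.card_le_card (Finset.filter_subset_filter _ (Finset.filter_subset _ _))
  have h3 := card_proper_primePowers_le (A := A) hx.le
  have hz : 1 ≤ x ^ (1 / 2 : ℝ) := Real.one_le_rpow hx.le (by norm_num)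
  have h4 := card_primes_le_mertensSum (A := A) hz
  rw [Real.log_rpow hx0] at hM
  set p := (((primePowers A (x ^ (1 / 2 : ℝ))).filter fun q => q.2 = 1).card : ℝ) with hp
  have hl2 : 0.69 < Real.log 2 := by linarith [Real.log_two_gt_d9]
  have hlx : 0 < Real.log x := Real.log_pos hx
  have h5 : p * Real.log 2 ≤ x ^ (1 / 2 : ℝ) * ((20 / 19) ^ 2 * (1 / 2 * Real.log x)) :=
    h4.trans (mul_le_mul_of_nonneg_left hM (by linarith))
  have h6 : p * (Real.log x / Real.log 2) ≤ x ^ (1 / 2 : ℝ) * Real.log x ^ (2 : ℝ) * 2 := by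
    rw [mul_div_assoc', div_le_iff₀ (by linarith)]
    have hp' : p ≤ x ^ (1 / 2 : ℝ) * Real.log x := by
      have : 0 < x ^ (1 / 2 : ℝ) * Real.log x := by positivity
      have hp0 : 0 ≤ p := Nat.cast_nonneg _
      nlinarith
    rw [Real.rpow_two]
    have : 0 < x ^ (1 / 2 : ℝ) * Real.log x ^ 2 := by positivity
    nlinarith
  have h7 : (T.card : ℝ) = ((T.filter fun q => q.2 = 1).card : ℝ) +
    ((T.filter fun q => q.2 ≠ 1).card : ℝ) := by exact_mod_cast hT1
  have h1' : ((T.filter fun q => q.2 = 1).card : ℝ) ≤ (primesInInterval A y x).ncard := by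
    exact_mod_cast h1
  have h2' : ((T.filter fun q => q.2 ≠ 1).card : ℝ) ≤
      ((primePowers A x).filter fun q => q.2 ≠ 1).card := by exact_mod_cast h2
  linarith

end PrimeCount

/-! ### Equidistribution of ideals in number fields -/

section IdealCount

open Submodule

universe u

variable {A : Type u} [CommRing A] [IsDedekindDomain A] [Ring.HasFiniteQuotients A] [Infinite A]

/-- The finset of nonzero ideals of norm at most `x`. -/
noncomputable def idealsLE (A : Type u) [CommRing A] [IsDedekindDomain A]
    [Ring.HasFiniteQuotients A] (x : ℝ) : Finset (Ideal A) :=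
  ((finite_cardQuot_le_real (A := A) x).subset (t := {I | I ≠ ⊥ ∧ (cardQuot I : ℝ) ≤ x})
    fun _ h => h.2).toFinset

theorem mem_idealsLE {x : ℝ} {I : Ideal A} :
    I ∈ idealsLE A x ↔ I ≠ ⊥ ∧ (cardQuot I : ℝ) ≤ x := Set.Finite.mem_toFinset _

theorem idealsLE_mono {x y : ℝ} (h : x ≤ y) : idealsLE A x ⊆ idealsLE A y := fun I hI => by
  rw [mem_idealsLE] at hI ⊢
  exact ⟨hI.1, hI.2.trans h⟩

open Classical in
theorem card_filter_dvd_idealsLE {Q : Ideal A} (hQ : Q ≠ ⊥) (x : ℝ) :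
    ((idealsLE A x).filter fun I => Q ∣ I).card = (idealsLE A (x / cardQuot Q)).card := by
  symm
  have hpos : (0 : ℝ) < cardQuot Q := by
    exact_mod_cast Ring.HasFiniteQuotients.cardQuot_pos Q hQ
  refine Finset.card_bij (fun J _ => Q * J) ?_ ?_ ?_
  · intro J hJ
    rw [mem_idealsLE, le_div_iff₀ hpos] at hJ
    refine Finset.mem_filter.2 ⟨mem_idealsLE.2 ⟨mul_ne_zero hQ hJ.1, ?_⟩, dvd_mul_right _ _⟩
    rw [cardQuot_mul_of_infinite, Nat.cast_mul, mul_comm]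
    exact hJ.2
  · intro J _ J' _ h
    exact mul_left_cancel₀ (show Q ≠ 0 from hQ) h
  · intro I hI
    obtain ⟨hI, J, rfl⟩ := Finset.mem_filter.1 hI
    rw [mem_idealsLE, cardQuot_mul_of_infinite, Nat.cast_mul, mul_comm (cardQuot Q : ℝ)] at hI
    exact ⟨J, mem_idealsLE.2 ⟨fun h => hI.1 (by rw [h, Ideal.mul_bot]),
      (le_div_iff₀ hpos).2 hI.2⟩, rfl⟩

/-- If the number of ideals of norm at most `x` is asymptotic to `κ * x`, then the ideals are
equidistributed. -/
theorem equidistributedIdeals_of_tendsto {κ : ℝ} (hκ : 0 < κ)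
    (h : Tendsto (fun x : ℝ => ((idealsLE A x).card : ℝ) / x) atTop (𝓝 κ)) :
    EquidistributedIdeals A := by
  classical
  have hlo := h.eventually (eventually_gt_nhds (show 99 / 100 * κ < κ by linarith))
  have hhi := h.eventually (eventually_lt_nhds (show κ < 101 / 100 * κ by linarith))
  obtain ⟨X, hX⟩ := eventually_atTop.1 ((hlo.and hhi).and (eventually_ge_atTop 1))
  have hb : ∀ x, X ≤ x → 99 / 100 * κ * x ≤ (idealsLE A x).card ∧
      ((idealsLE A x).card : ℝ) ≤ 101 / 100 * κ * x ∧ 1 ≤ x := by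
    intro x hx
    obtain ⟨⟨h1, h2⟩, h3⟩ := hX x hx
    have hx0 : 0 < x := by linarith
    exact ⟨((lt_div_iff₀ hx0).1 h1).le, ((div_lt_iff₀ hx0).1 h2).le, h3⟩
  -- A linear upper bound valid at every positive argument is needed because x/|Q| may be small:
  -- below 1 there are no ideals, between 1 and X at most as many as at X.
  set D := ((idealsLE A X).card : ℝ) + 101 / 100 * κ with hD
  have hub : ∀ x : ℝ, 0 < x → ((idealsLE A x).card : ℝ) ≤ D * x := by
    intro x hx
    rcases le_total X x with hXx | hxX
    · have := (hb x hXx).2.1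
      have : 0 ≤ ((idealsLE A X).card : ℝ) * x := by positivity
      rw [hD]
      linarith
    · rcases lt_or_ge x 1 with hx1 | hx1
      · have : idealsLE A x = ∅ := by
          refine Finset.eq_empty_of_forall_notMem fun I hI => ?_
          rw [mem_idealsLE] at hI
          have := Ring.HasFiniteQuotients.cardQuot_pos I hI.1
          have : (1 : ℝ) ≤ cardQuot I := by exact_mod_cast this
          linarith
        rw [this]
        simp only [Finset.card_empty, Nat.cast_zero]
        positivity
      · have h1 : ((idealsLE A x).card : ℝ) ≤ (idealsLE A X).card := by
          exact_mod_cast Finset.card_le_card (idealsLE_mono hxX)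
        have h2 : (0 : ℝ) ≤ (idealsLE A X).card := by positivity
        rw [hD]
        nlinarith
  have hsm : ∀ᶠ x : ℝ in atTop, 2 * x ^ (98 / 100 : ℝ) ≤ 1 / 100 * x := by
    filter_upwards [(tendsto_rpow_atTop (show (0 : ℝ) < 2 / 100 by norm_num)).eventually_ge_atTop
      200, eventually_gt_atTop 0] with x hx hx0
    have e : x = x ^ (98 / 100 : ℝ) * x ^ (2 / 100 : ℝ) := by
      rw [← Real.rpow_add hx0]; norm_num
    have : 0 < x ^ (98 / 100 : ℝ) := by positivity
    nlinarith
  have h5 := (tendsto_rpow_atTop (show (0 : ℝ) < 1 / 20 by norm_num)).eventually_ge_atTop X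
  have h98 := (tendsto_rpow_atTop (show (0 : ℝ) < 98 / 100 by norm_num)).eventually_ge_atTop X
  refine ⟨D / (99 / 100 * κ), ?_⟩
  filter_upwards [hsm, h5, h98, eventually_ge_atTop X, eventually_gt_atTop 1]
    with x hsm h5 h98 hxX hx1
  have hx0 : 0 < x := by linarith
  obtain ⟨b1, b2, -⟩ := hb x hxX
  obtain ⟨-, c2, -⟩ := hb _ h98
  refine ⟨Ideal A, idealsLE A x, id, ?_, fun I hI => mem_idealsLE.1 hI, ?_, fun Q hQ => ?_⟩
  · rw [← Finset.card_pos]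
    have : (0 : ℝ) < (idealsLE A x).card := lt_of_lt_of_le (by positivity) b1
    exact_mod_cast this
  -- At least 99% of the ideals have norm above x^(98/100), and 99/100 · 98/100 > 19/20.
  · set T := idealsLE A x \ idealsLE A (x ^ (98 / 100 : ℝ)) with hT
    have hsub : idealsLE A (x ^ (98 / 100 : ℝ)) ⊆ idealsLE A x := idealsLE_mono
      ((Real.rpow_le_rpow_of_exponent_le hx1.le (by norm_num)).trans_eq (Real.rpow_one x))
    have hTc : (T.card : ℝ) = (idealsLE A x).card - (idealsLE A (x ^ (98 / 100 : ℝ))).card := by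
      rw [hT, Finset.card_sdiff_of_subset hsub, Nat.cast_sub (Finset.card_le_card hsub)]
    have h1 : (T.card : ℝ) * (98 / 100 * Real.log x) ≤
        ∑ I ∈ idealsLE A x, Real.log (cardQuot (id I)) := by
      rw [← nsmul_eq_mul]
      refine (Finset.card_nsmul_le_sum T (fun I => Real.log (cardQuot I)) _ fun I hI => ?_).trans
        (Finset.sum_le_sum_of_subset_of_nonneg Finset.sdiff_subset fun I _ _ =>
          log_cardQuot_nonneg I)
      rw [hT, Finset.mem_sdiff, mem_idealsLE, mem_idealsLE] at hI
      rw [← Real.log_rpow hx0]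
      refine Real.log_le_log (by positivity) ?_
      by_contra! hlt
      exact hI.2 ⟨hI.1.1, hlt.le⟩
    refine le_trans ?_ h1
    have hl : 0 < Real.log x := Real.log_pos hx1
    have : 99 / 100 * ((idealsLE A x).card : ℝ) ≤ T.card := by
      rw [hTc]
      nlinarith
    nlinarith
  · have hpos : (0 : ℝ) < cardQuot Q := by
      exact_mod_cast Ring.HasFiniteQuotients.cardQuot_pos Q hQ
    simp only [id]
    rw [card_filter_dvd_idealsLE hQ]
    have hcan : (cardQuot Q : ℝ) * (x / cardQuot Q) = x := mul_div_cancel₀ _ hpos.ne'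
    have hlow : (cardQuot Q : ℝ) ≤ x ^ (19 / 20 : ℝ) → X ≤ x / cardQuot Q := by
      intro hle
      refine h5.trans ((le_div_iff₀ hpos).2 ?_)
      calc x ^ (1 / 20 : ℝ) * cardQuot Q ≤ x ^ (1 / 20 : ℝ) * x ^ (19 / 20 : ℝ) := by gcongr
        _ = x := by rw [← Real.rpow_add hx0]; norm_num
    refine ⟨fun hle => ?_, fun hle => ?_, fun hle => ?_⟩
    · have := mul_le_mul_of_nonneg_left (hb _ (hlow hle)).1 hpos.le
      nlinarith
    · have := mul_le_mul_of_nonneg_left (hb _ (hlow (hle.trans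
        (Real.rpow_le_rpow_of_exponent_le hx1.le (by norm_num))))).2.1 hpos.le
      nlinarith
    · have h1 := mul_le_mul_of_nonneg_left (hub (x / cardQuot Q) (by positivity)) hpos.le
      have h2 := mul_le_mul_of_nonneg_right hle
        (Nat.cast_nonneg (α := ℝ) (idealsLE A (x / cardQuot Q)).card)
      have hD0 : 0 < D := by positivity
      have e : (cardQuot Q : ℝ) * (D * (x / cardQuot Q)) = D * x := by
        rw [mul_left_comm, hcan]
      rw [e] at h1
      refine (h2.trans h1).trans ?_
      rw [div_mul_eq_mul_div, le_div_iff₀ (by positivity)]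
      nlinarith [mul_le_mul_of_nonneg_left b1 hD0.le]

/-- The density κ is the residue at 1 of the Dedekind zeta function, which is positive. -/
theorem NumberField.equidistributedIdeals (K : Type u) [Field K] [NumberField K] :
    EquidistributedIdeals (NumberField.RingOfIntegers K) := by
  refine equidistributedIdeals_of_tendsto (NumberField.dedekindZeta_residue_pos K)
    ((NumberField.Ideal.tendsto_norm_le_div_atTop₀ K).congr fun x => ?_)
  congr 2
  rw [← Nat.card_eq_finsetCard]
  refine Nat.card_congr ((Equiv.subtypeSubtypeEquivSubtypeInter _
    fun I : Ideal (NumberField.RingOfIntegers K) => (Ideal.absNorm I : ℝ) ≤ x).trans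
    (Equiv.subtypeEquivRight fun I => ?_))
  rw [mem_idealsLE, mem_nonZeroDivisors_iff_ne_zero]
  rfl

end IdealCount

/-! ### Arithmetic of dimension sequences -/

section LatticeDimension

/-- Here h n is to be the dimension of I within the box of degree < n, δ the codimension of I, D the
rank. As h vanishes until nD + c reaches δ and then gains at most D per step, it cannot overtake nD
− δ by more than c + D. -/
theorem dimension_le_of_increments {h e : ℕ → ℕ} {D δ c : ℕ} (hD : 1 ≤ D)
    (hstep : ∀ n, h (n + 1) = h n + e n) (he : ∀ n, e n ≤ D) (h0 : h 0 = 0)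
    (hvan : ∀ n, n * D + c < δ → h n = 0) (n : ℕ) : h n = 0 ∨ h n + δ ≤ n * D + c + D := by
  have hgen : ∀ m, h m = 0 → ∀ j, h (m + j) ≤ j * D := by
    intro m hm j
    induction j with
    | zero => simp [hm]
    | succ j ih => rw [← add_assoc, hstep, Nat.succ_mul]; exact Nat.add_le_add ih (he _)
  rcases Nat.lt_or_ge (n * D + c) δ with hlt | hge
  · exact Or.inl (hvan n hlt)
  right
  rcases Nat.lt_or_ge c δ with hc | hc
  · set m := (δ - c - 1) / D with hm
    have h1 : m * D ≤ δ - c - 1 := Nat.div_mul_le_self _ _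
    have h2 : δ - c - 1 < m * D + D := by
      have := Nat.lt_mul_div_succ (δ - c - 1) (b := D) (by omega)
      rw [← hm] at this; linarith
    have hmn : m ≤ n := by
      by_contra! hlt
      have := Nat.mul_le_mul_right D hlt.le
      omega
    obtain ⟨j, rfl⟩ := Nat.exists_eq_add_of_le hmn
    have h3 := hgen m (hvan m (by omega)) j
    rw [Nat.add_mul]
    omega
  · have := hgen 0 h0 n
    rw [Nat.zero_add] at this
    omega

/-- Once a nondecreasing increment reaches its maximum D it stays there, so the eventual identity
propagates back. If it had not reached D before n, h would lose at least one unit per step against D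
and violate `hlow`. -/
theorem dimension_eq_of_increments {h e : ℕ → ℕ} {D δ c : ℕ} (hD : 1 ≤ D)
    (hstep : ∀ n, h (n + 1) = h n + e n) (he : ∀ n, e n ≤ D) (hmono : Monotone e) (h0 : h 0 = 0)
    (hvan : ∀ n, n * D + c < δ → h n = 0) (hlow : ∀ n, n * D ≤ h n + δ)
    (hev : ∀ᶠ n in atTop, h n + δ = n * D) {n : ℕ} (hn : δ + D * (c + D) ≤ n * D) :
    h n + δ = n * D := by
  have hex : ∃ j < n, e j = D := by
    by_contra! hne
    have hgen : ∀ m, h m = 0 → ∀ j, m + j ≤ n → h (m + j) + j ≤ j * D := by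
      intro m hm j
      induction j with
      | zero => simp [hm]
      | succ j ih =>
        intro hj
        have := ih (by omega)
        have h1 := hne (m + j) (by omega)
        have h2 := he (m + j)
        rw [show m + (j + 1) = m + j + 1 from rfl, hstep, Nat.succ_mul]
        omega
    -- m is a zero of h with mD within c + D of δ; the later steps up to n, each losing a unit,
    -- number at most δ − mD ≤ c + D.
    obtain ⟨m, hm0, hmn, hmD⟩ : ∃ m, h m = 0 ∧ m ≤ n ∧ δ ≤ m * D + c + D := by
      rcases Nat.lt_or_ge c δ with hc | hc
      · set m := (δ - c - 1) / D with hm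
        have h1 : m * D ≤ δ - c - 1 := Nat.div_mul_le_self _ _
        have h2 : δ - c - 1 < m * D + D := by
          have := Nat.lt_mul_div_succ (δ - c - 1) (b := D) (by omega)
          rw [← hm] at this; linarith
        refine ⟨m, hvan m (by omega), ?_, by omega⟩
        by_contra! hlt
        have h3 := Nat.mul_le_mul_right D hlt.le
        have h4 : 0 ≤ D * (c + D) := Nat.zero_le _
        omega
      · exact ⟨0, h0, Nat.zero_le _, by omega⟩
    obtain ⟨j, rfl⟩ := Nat.exists_eq_add_of_le hmn
    have h1 := hgen m hm0 j le_rfl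
    have h2 := hlow (m + j)
    have h3 : m * D + j ≤ δ := by rw [Nat.add_mul] at h2; omega
    have h4 := Nat.mul_le_mul_right D h3
    obtain ⟨d, rfl⟩ := Nat.exists_eq_add_of_le hD
    nlinarith
  obtain ⟨j, hjn, hj⟩ := hex
  obtain ⟨N, hN⟩ := eventually_atTop.1 hev
  have hup : ∀ i, h (n + i) + n * D = h n + (n + i) * D := by
    intro i
    induction i with
    | zero => simp
    | succ i ih =>
      have : e (n + i) = D := le_antisymm (he _) (hj ▸ hmono (by omega))
      rw [← add_assoc, hstep, this, Nat.succ_mul]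
      omega
  have h1 := hup N
  have h2 := hN (n + N) (by omega)
  omega

end LatticeDimension

/-! ### Boxes in a free `k[X]`-algebra and weak Riemann–Roch -/

section Box

open Polynomial Submodule

universe u

variable (k : Type*) [Field k] {A : Type u} [CommRing A] [Algebra k[X] A] [Algebra k A]
  [IsScalarTower k k[X] A] {ι : Type*} [Fintype ι] (b : Module.Basis ι k[X] A)

/-- The elements of `A` whose coordinates have degree `< n`. -/
noncomputable def degreeBox (n : ℕ) : Submodule k A :=
  ⨅ i, (degreeLT k n).comap ((b.coord i).restrictScalars k)

/-- The coefficients of `X ^ n` in the coordinates. -/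
noncomputable def coordCoeff (n : ℕ) : A →ₗ[k] (ι → k) :=
  LinearMap.pi fun i => lcoeff k n ∘ₗ (b.coord i).restrictScalars k

variable {k}

theorem mem_degreeBox {n : ℕ} {f : A} : f ∈ degreeBox k b n ↔ ∀ i, (b.repr f i).degree < n := by
  simp [degreeBox, mem_degreeLT]

theorem coordCoeff_apply (n : ℕ) (f : A) (i : ι) :
    coordCoeff k b n f i = (b.repr f i).coeff n := rfl

theorem degreeBox_mono {m n : ℕ} (h : m ≤ n) : degreeBox k b m ≤ degreeBox k b n := fun f hf => by
  rw [mem_degreeBox] at hf ⊢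
  exact fun i => (hf i).trans_le (by exact_mod_cast h)

theorem degreeBox_zero : degreeBox k b 0 = ⊥ := by
  rw [eq_bot_iff]
  intro f hf
  rw [mem_degreeBox] at hf
  rw [Submodule.mem_bot, ← b.repr.map_eq_zero_iff]
  ext1 i
  simpa [Nat.WithBot.lt_zero_iff] using hf i

theorem mem_degreeBox_iff_coordCoeff {n : ℕ} {f : A} :
    f ∈ degreeBox k b n ↔ f ∈ degreeBox k b (n + 1) ∧ coordCoeff k b n f = 0 := by
  simp only [mem_degreeBox, funext_iff, coordCoeff_apply, Pi.zero_apply, ← forall_and]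
  refine forall_congr' fun i => ⟨fun h => ⟨h.trans (by exact_mod_cast n.lt_succ_self),
    coeff_eq_zero_of_degree_lt h⟩, fun ⟨h1, h2⟩ => ?_⟩
  rw [degree_lt_iff_coeff_zero] at h1 ⊢
  intro m hm
  rcases hm.eq_or_lt with rfl | hm
  · exact h2
  · exact h1 m hm

instance finiteDimensional_degreeBox (n : ℕ) : FiniteDimensional k (degreeBox k b n) := by
  let φ : degreeBox k b n →ₗ[k] (Fin n → ι → k) :=
    LinearMap.pi fun j => coordCoeff k b j ∘ₗ (degreeBox k b n).subtype
  refine FiniteDimensional.of_injective φ ((injective_iff_map_eq_zero φ).2 fun f hf => ?_)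
  rw [← Subtype.coe_inj, Submodule.coe_zero, ← b.repr.map_eq_zero_iff]
  ext i m
  rcases Nat.lt_or_ge m n with hm | hm
  · exact congrFun (congrFun hf ⟨m, hm⟩) i
  · have := (mem_degreeBox b).1 f.2 i
    rw [degree_lt_iff_coeff_zero] at this
    exact this m hm

theorem exists_mem_degreeBox (f : A) : ∃ n, f ∈ degreeBox k b n := by
  refine ⟨(Finset.univ.sup fun i => (b.repr f i).natDegree) + 1, (mem_degreeBox b).2 fun i => ?_⟩
  refine degree_le_natDegree.trans_lt ?_
  have := Finset.le_sup (f := fun i => (b.repr f i).natDegree) (Finset.mem_univ i)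
  exact_mod_cast Nat.lt_succ_of_le this

theorem finrank_eq_map_add_ker {V M : Type*} [AddCommGroup V] [Module k V] [AddCommGroup M]
    [Module k M] (W : Submodule k V) [FiniteDimensional k W] (f : V →ₗ[k] M) :
    Module.finrank k W = Module.finrank k (W.map f) +
      Module.finrank k (W ⊓ LinearMap.ker f : Submodule k V) := by
  rw [← LinearMap.finrank_range_add_finrank_ker (f.domRestrict W), LinearMap.range_domRestrict,
    LinearMap.ker_domRestrict]
  rw [← Submodule.map_comap_subtype, Submodule.finrank_map_subtype_eq]

/-- The leading coefficients in degree `n` of a subspace. -/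
noncomputable def leadingSpace (I : Submodule k A) (n : ℕ) : Submodule k (ι → k) :=
  (degreeBox k b (n + 1) ⊓ I).map (coordCoeff k b n)

/-- Rank–nullity for the coefficient of X^n: its kernel on the box of degree < n + 1 is the box of
degree < n. -/
theorem finrank_degreeBox_succ (I : Submodule k A) (n : ℕ) :
    Module.finrank k (degreeBox k b (n + 1) ⊓ I : Submodule k A) =
      Module.finrank k (degreeBox k b n ⊓ I : Submodule k A) +
        Module.finrank k (leadingSpace b I n) := by
  have : FiniteDimensional k (degreeBox k b (n + 1) ⊓ I : Submodule k A) :=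
    Submodule.finiteDimensional_of_le inf_le_left
  have hker : degreeBox k b n ⊓ I =
      degreeBox k b (n + 1) ⊓ I ⊓ LinearMap.ker (coordCoeff k b n) := by
    ext f
    rw [mem_inf, mem_inf, mem_inf, mem_degreeBox_iff_coordCoeff (n := n), LinearMap.mem_ker]
    tauto
  rw [hker, leadingSpace, finrank_eq_map_add_ker (degreeBox k b (n + 1) ⊓ I) (coordCoeff k b n)]
  exact add_comm _ _

theorem repr_X_smul (f : A) (i : ι) : b.repr ((X : k[X]) • f) i = X * b.repr f i := by
  rw [map_smul]; rfl

/-- Multiplication by X preserves I and shifts leading coefficients by one degree. This makes the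
dimension increments nondecreasing. -/
theorem leadingSpace_le_succ (I : Ideal A) (n : ℕ) :
    leadingSpace b (I.restrictScalars k) n ≤ leadingSpace b (I.restrictScalars k) (n + 1) := by
  rintro _ ⟨f, ⟨hf, hfI⟩, rfl⟩
  refine ⟨(X : k[X]) • f, ⟨(mem_degreeBox b).2 fun i => ?_, ?_⟩, ?_⟩
  · have := (mem_degreeBox b).1 hf i
    rw [degree_lt_iff_coeff_zero] at this ⊢
    intro m hm
    obtain ⟨m, rfl⟩ := Nat.exists_eq_add_of_le' (show 1 ≤ m by omega)
    rw [repr_X_smul, coeff_X_mul]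
    exact this m (by omega)
  · rw [Algebra.smul_def]
    exact I.mul_mem_left _ hfI
  · ext i
    rw [coordCoeff_apply, repr_X_smul, coeff_X_mul, coordCoeff_apply]

theorem leadingSpace_top (n : ℕ) : leadingSpace b ⊤ n = ⊤ := by
  classical
  rw [eq_top_iff]
  intro y _
  refine ⟨b.equivFun.symm fun i => C (y i) * X ^ n, ⟨(mem_degreeBox b).2 fun i => ?_, trivial⟩, ?_⟩
  · rw [← b.equivFun_apply, LinearEquiv.apply_symm_apply]
    exact (degree_C_mul_X_pow_le _ _).trans_lt (by exact_mod_cast n.lt_succ_self)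
  · ext i
    rw [coordCoeff_apply, ← b.equivFun_apply, LinearEquiv.apply_symm_apply]
    simp

theorem finrank_degreeBox (n : ℕ) :
    Module.finrank k (degreeBox k b n) = n * Fintype.card ι := by
  induction n with
  | zero => rw [degreeBox_zero]; simp
  | succ n ih =>
    have := finrank_degreeBox_succ b ⊤ n
    rw [inf_top_eq, inf_top_eq, leadingSpace_top, finrank_top, Module.finrank_pi, ih] at this
    rw [this, Nat.succ_mul]

theorem finrank_degreeBox_inf_add (I : Ideal A) (n : ℕ) :
    n * Fintype.card ι = Module.finrank k
      ((degreeBox k b n).map (Ideal.Quotient.mkₐ k I).toLinearMap) +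
        Module.finrank k (degreeBox k b n ⊓ I.restrictScalars k : Submodule k A) := by
  have hker : LinearMap.ker (Ideal.Quotient.mkₐ k I).toLinearMap = I.restrictScalars k := by
    ext f
    simp [Ideal.Quotient.eq_zero_iff_mem]
  rw [← finrank_degreeBox b n, ← hker, ← finrank_eq_map_add_ker]

variable {b}

/-- A weak Riemann–Roch theorem: the constraint `hc` empties I of nonzero elements in small boxes,
which feeds the two arithmetic lemmas on increments. The first conclusion holds for all n, the exact
dimension only for large boxes. -/
theorem finrank_degreeBox_inf_eq [Nontrivial A] {c : ℕ} {I : Ideal A}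
    [FiniteDimensional k (A ⧸ I)]
    (hc : ∀ n, ∀ f ∈ degreeBox k b n, f ≠ 0 → f ∈ I →
      Module.finrank k (A ⧸ I) ≤ n * Fintype.card ι + c) :
    (∀ n, degreeBox k b n ⊓ I.restrictScalars k = ⊥ ∨
      Module.finrank k (degreeBox k b n ⊓ I.restrictScalars k : Submodule k A) +
        Module.finrank k (A ⧸ I) ≤ n * Fintype.card ι + c + Fintype.card ι) ∧
    ∀ n, Module.finrank k (A ⧸ I) + Fintype.card ι * (c + Fintype.card ι) ≤ n * Fintype.card ι →
      Module.finrank k (degreeBox k b n ⊓ I.restrictScalars k : Submodule k A) +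
        Module.finrank k (A ⧸ I) = n * Fintype.card ι := by
  have hfin : ∀ n, FiniteDimensional k (degreeBox k b n ⊓ I.restrictScalars k : Submodule k A) :=
    fun n => Submodule.finiteDimensional_of_le inf_le_left
  have hD : 1 ≤ Fintype.card ι := Fintype.card_pos_iff.2 b.index_nonempty
  have hvan : ∀ n, n * Fintype.card ι + c < Module.finrank k (A ⧸ I) →
      degreeBox k b n ⊓ I.restrictScalars k = ⊥ := by
    intro n hn
    rw [eq_bot_iff]
    rintro f ⟨hf, hfI⟩
    by_contra hf0
    exact absurd (hc n f hf hf0 hfI) (by omega)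
  have hvan' : ∀ n, n * Fintype.card ι + c < Module.finrank k (A ⧸ I) →
      Module.finrank k (degreeBox k b n ⊓ I.restrictScalars k : Submodule k A) = 0 := by
    intro n hn
    rw [hvan n hn, finrank_bot]
  have hstep := finrank_degreeBox_succ b (I.restrictScalars k)
  have he : ∀ n, Module.finrank k (leadingSpace b (I.restrictScalars k) n) ≤ Fintype.card ι :=
    fun n => (Submodule.finrank_le _).trans_eq (Module.finrank_pi k)
  have h0 : Module.finrank k (degreeBox k b 0 ⊓ I.restrictScalars k : Submodule k A) = 0 := by
    rw [degreeBox_zero, bot_inf_eq, finrank_bot]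
  refine ⟨fun n => ?_, fun n hn => ?_⟩
  · refine (dimension_le_of_increments hD hstep he h0 hvan' n).imp_left fun h => ?_
    exact Submodule.finrank_eq_zero.1 h
  · refine dimension_eq_of_increments hD hstep he (monotone_nat_of_le_succ fun n =>
      Submodule.finrank_mono (leadingSpace_le_succ b I n)) h0 hvan' (fun n => ?_) ?_ hn
    · have h1 := finrank_degreeBox_inf_add b I n
      have h2 := Submodule.finrank_le
        ((degreeBox k b n).map (Ideal.Quotient.mkₐ k I).toLinearMap)
      omega
    -- The boxes exhaust A, so they eventually surject onto the finite-dimensional quotient, and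
    -- rank–nullity gives the identity.
    · have hN : ∃ N, ∀ n ≥ N, (degreeBox k b n).map (Ideal.Quotient.mkₐ k I).toLinearMap = ⊤ := by
        obtain ⟨s, hs⟩ := (Module.finite_def.1 (inferInstance : Module.Finite k (A ⧸ I)))
        have : ∀ y : A ⧸ I, ∃ n, y ∈ (degreeBox k b n).map
            (Ideal.Quotient.mkₐ k I).toLinearMap := by
          intro y
          obtain ⟨f, rfl⟩ := Ideal.Quotient.mk_surjective y
          obtain ⟨n, hn⟩ := exists_mem_degreeBox b f
          exact ⟨n, f, hn, rfl⟩
        choose m hm using this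
        refine ⟨s.sup m, fun n hn => ?_⟩
        rw [eq_top_iff, ← hs, span_le]
        intro y hy
        exact Submodule.map_mono (degreeBox_mono b ((Finset.le_sup hy).trans hn)) (hm y)
      obtain ⟨N, hN⟩ := hN
      filter_upwards [eventually_ge_atTop N] with n hn
      have h1 := finrank_degreeBox_inf_add b I n
      rw [hN n hn, finrank_top] at h1
      omega

end Box

/-! ### Small values of monic polynomials over `k[X]` -/

section MonicValues

open Polynomial

variable {k : Type*} [Field k] [Fintype k]

instance finite_degreeLT (n : ℕ) : Finite (degreeLT k n) :=
  Finite.of_injective _ (degreeLTEquiv k n).injective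

/-- The finset of polynomials of degree `< n`. -/
noncomputable def polysLT (k : Type*) [Field k] [Fintype k] (n : ℕ) : Finset k[X] :=
  have : Finite (degreeLT k n : Set k[X]) := finite_degreeLT n
  (Set.toFinite (degreeLT k n : Set k[X])).toFinset

theorem mem_polysLT {n : ℕ} {x : k[X]} : x ∈ polysLT k n ↔ x.degree < n := by
  rw [polysLT, Set.Finite.mem_toFinset, SetLike.mem_coe, mem_degreeLT]

theorem card_polysLT (n : ℕ) : (polysLT k n).card = Fintype.card k ^ n := by
  have h : ((polysLT k n : Finset k[X]) : Set k[X]) = degreeLT k n := by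
    ext x
    rw [Finset.mem_coe, mem_polysLT, SetLike.mem_coe, mem_degreeLT]
  rw [← Set.ncard_coe_finset, h]
  change Nat.card (degreeLT k n) = _
  rw [Nat.card_congr (degreeLTEquiv k n).toEquiv, Nat.card_fun, Nat.card_eq_fintype_card,
    Nat.card_eq_fintype_card, Fintype.card_fin]

/-- A monic polynomial over `k[X]` takes few values of small degree. -/
theorem card_le_of_degree_eval_lt (r : ℕ) : ∀ (D : ℕ) (χ : k[X][X]), χ.Monic → χ.natDegree = D →
    ∀ S : Finset k[X], (∀ x ∈ S, (χ.eval x).degree < (D * r : ℕ)) →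
      S.card ≤ D * Fintype.card k ^ r := by
  classical
  intro D
  induction D with
  | zero =>
    intro χ hχ hD S hS
    rw [Polynomial.eq_one_of_monic_natDegree_zero hχ hD] at hS
    have : S = ∅ := Finset.eq_empty_of_forall_notMem fun x hx => by simpa using hS x hx
    simp [this]
  | succ D ih =>
    intro χ hχ hD S hS
    rcases S.eq_empty_or_nonempty with rfl | ⟨x₀, hx₀⟩
    · simp
    set χ₁ := χ /ₘ (X - C x₀) with hχ₁
    have hdeg : χ₁.natDegree = D := by
      rw [hχ₁, natDegree_divByMonic _ (monic_X_sub_C _), hD, natDegree_X_sub_C]; rfl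
    have hmon : χ₁.Monic := by
      rw [Monic, hχ₁, leadingCoeff_divByMonic_X_sub_C _ _ x₀]
      · exact hχ
      · rw [degree_eq_natDegree hχ.ne_zero, hD]
        exact_mod_cast D.succ_ne_zero
    have hfac : ∀ x, (x - x₀) * χ₁.eval x = χ.eval x - χ.eval x₀ := by
      intro x
      have h := congrArg (eval x) (modByMonic_add_div χ (X - C x₀))
      rw [modByMonic_X_sub_C_eq_C_eval, eval_add, eval_mul, eval_sub, eval_X, eval_C, eval_C] at h
      rw [← h]; ring
    -- Since (x − x₀)·χ₁(x) = χ(x) − χ(x₀) has degree < (D + 1)r, either x − x₀ has degree < r,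
    -- which leaves q^r choices, or χ₁(x) has degree < Dr and induction applies.
    rw [← Finset.card_filter_add_card_filter_not (s := S) fun x => (x - x₀).degree < r,
      Nat.succ_mul, add_comm]
    refine Nat.add_le_add (ih χ₁ hmon hdeg _ fun x hx => ?_) ?_
    · obtain ⟨hxS, hxr⟩ := Finset.mem_filter.1 hx
      have h1 : ((x - x₀) * χ₁.eval x).degree < ((D + 1) * r : ℕ) := by
        rw [hfac]
        exact (degree_sub_le _ _).trans_lt (max_lt (hS x hxS) (hS x₀ hx₀))
      rw [degree_mul] at h1
      by_cases h0 : χ₁.eval x = 0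
      · rw [h0, degree_zero]; exact WithBot.bot_lt_coe _
      have hx0 : x - x₀ ≠ 0 := fun h => hxr (by rw [h, degree_zero]; exact WithBot.bot_lt_coe _)
      rw [degree_eq_natDegree h0] at h1 ⊢
      rw [degree_eq_natDegree hx0] at h1 hxr
      norm_cast at h1 hxr ⊢
      rw [Nat.succ_mul] at h1
      omega
    · rw [← card_polysLT]
      refine Finset.card_le_card_of_injOn (fun x => x - x₀) (fun x hx => ?_)
        fun x _ y _ h => sub_left_injective h
      exact mem_polysLT.2 (Finset.mem_filter.1 hx).2

end MonicValues

/-! ### Norms of the elements of a box -/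

section BoxNorm

open Polynomial Submodule

universe u

variable {k : Type*} [Field k] [Fintype k] {A : Type u} [CommRing A] [IsDomain A] [Algebra k[X] A]
  [Algebra k A] [IsScalarTower k k[X] A] {ι : Type*} [Fintype ι] (b : Module.Basis ι k[X] A)

theorem hasFiniteQuotients_polynomial : Ring.HasFiniteQuotients k[X] where
  finiteQuotient {I} hI := by
    obtain ⟨p, rfl⟩ := IsPrincipalIdealRing.principal I
    have hp : p ≠ 0 := fun h => hI (by simp [h])
    have : Module.Finite k (k[X] ⧸ Ideal.span {p}) :=
      PowerBasis.finite (AdjoinRoot.powerBasis hp)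
    exact Module.finite_of_finite k

theorem hasFiniteQuotients_of_basis (b : Module.Basis ι k[X] A) : Ring.HasFiniteQuotients A := by
  have := hasFiniteQuotients_polynomial (k := k)
  have := Module.Finite.of_basis b
  exact .of_module_finite k[X] A

theorem infinite_of_basis (b : Module.Basis ι k[X] A) : Infinite A := by
  have := Module.Free.of_basis b
  exact Module.Free.infinite k[X] A

theorem cardQuot_eq_pow_finrank {I : Ideal A} [FiniteDimensional k (A ⧸ I)] :
    cardQuot I = Fintype.card k ^ Module.finrank k (A ⧸ I) := by
  rw [← Nat.card_eq_fintype_card, ← Module.natCard_eq_pow_finrank]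
  rfl

theorem cardQuot_span_eq_cardPowDegree (b : Module.Basis ι k[X] A) {f : A} (hf : f ≠ 0) :
    (cardQuot (Ideal.span {f}) : ℤ) = cardPowDegree (Algebra.norm k[X] f) := by
  have := Module.Finite.of_basis b
  have := Module.Free.of_basis b
  have hn : Algebra.norm k[X] f ≠ 0 := Algebra.norm_ne_zero_iff.2 hf
  have := hasFiniteQuotients_of_basis b
  have : Finite (A ⧸ Ideal.span {f}) := Ring.HasFiniteQuotients.finiteQuotient (by simpa using hf)
  have : FiniteDimensional k (A ⧸ Ideal.span {f}) := Module.Finite.of_finite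
  rw [cardPowDegree_nonzero _ hn, ← finrank_quotient_span_eq_natDegree_norm b hf,
    cardQuot_eq_pow_finrank (k := k)]
  push_cast
  rfl

/-- The norm is a determinant of size D with entries linear in the coordinates; q^c dominates the
constant `normBound` of the basis. -/
theorem exists_cardQuot_span_le : ∃ c : ℕ, ∀ n, ∀ f ∈ degreeBox k b n, f ≠ 0 →
    cardQuot (Ideal.span {f}) ≤ Fintype.card k ^ (n * Fintype.card ι + c) := by
  classical
  have hq : 1 < Fintype.card k := Fintype.one_lt_card
  obtain ⟨c, hc⟩ := pow_unbounded_of_one_lt (ClassGroup.normBound cardPowDegree b)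
    (show (1 : ℤ) < Fintype.card k by exact_mod_cast hq)
  refine ⟨c, fun n f hf hf0 => ?_⟩
  have h1 := ClassGroup.norm_le cardPowDegree b f (y := (Fintype.card k : ℤ) ^ n) fun i => by
    rw [cardPowDegree_apply]
    split_ifs with h
    · positivity
    · have := (mem_degreeBox b).1 hf i
      rw [degree_eq_natDegree h] at this
      exact pow_le_pow_right₀ (by exact_mod_cast hq.le) (by exact_mod_cast this.le)
  rw [← cardQuot_span_eq_cardPowDegree b hf0, ← pow_mul] at h1
  have h2 : (cardQuot (Ideal.span {f}) : ℤ) ≤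
      (Fintype.card k : ℤ) ^ c * (Fintype.card k : ℤ) ^ (n * Fintype.card ι) :=
    h1.trans (mul_le_mul_of_nonneg_right hc.le (by positivity))
  rw [add_comm, pow_add]
  exact_mod_cast h2

/-- `degreeBox` as a finset. -/
noncomputable def boxFinset (n : ℕ) : Finset A :=
  have : Finite (degreeBox k b n) := Module.finite_of_finite k
  (Set.toFinite (degreeBox k b n : Set A)).toFinset

theorem mem_boxFinset {n : ℕ} {f : A} : f ∈ boxFinset b n ↔ f ∈ degreeBox k b n := by
  rw [boxFinset, Set.Finite.mem_toFinset, SetLike.mem_coe]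

open Classical in
theorem card_filter_boxFinset (n : ℕ) (I : Ideal A) : ((boxFinset b n).filter (· ∈ I)).card =
    Fintype.card k ^ Module.finrank k
      (degreeBox k b n ⊓ I.restrictScalars k : Submodule k A) := by
  have : FiniteDimensional k (degreeBox k b n ⊓ I.restrictScalars k : Submodule k A) :=
    Submodule.finiteDimensional_of_le inf_le_left
  rw [← Nat.card_eq_fintype_card, ← Module.natCard_eq_pow_finrank, ← Set.ncard_coe_finset]
  change Nat.card _ = _
  congr 2
  ext f
  simp [mem_boxFinset]

theorem card_boxFinset (n : ℕ) :
    (boxFinset b n).card = Fintype.card k ^ (n * Fintype.card ι) := by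
  classical
  have := card_filter_boxFinset b n ⊤
  rw [show (⊤ : Ideal A).restrictScalars k = ⊤ from rfl, inf_top_eq, finrank_degreeBox] at this
  simpa using this

open Classical in
/-- Most elements of a box have norm of almost maximal degree. -/
theorem exists_card_filter_norm_lt : ∃ J : ℕ, ∀ n ≥ J,
    100 * ((boxFinset b n).filter fun f =>
      (Algebra.norm k[X] f).degree < (Fintype.card ι * (n - J) : ℕ)).card ≤
        Fintype.card k ^ (n * Fintype.card ι) := by
  have hfin := Module.Finite.of_basis b
  have hfree := Module.Free.of_basis b
  have hq : 1 < Fintype.card k := Fintype.one_lt_card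
  obtain ⟨m, hm⟩ := exists_mem_degreeBox b (1 : A)
  obtain ⟨j, hj⟩ := pow_unbounded_of_one_lt (100 * Fintype.card ι) hq
  -- m makes room for translates by polynomials of degree < r + j to stay in the box; j makes q^j
  -- beat the factor 100·D.
  refine ⟨m + j, fun n hn => ?_⟩
  obtain ⟨r, rfl⟩ := Nat.exists_eq_add_of_le' hn
  rw [Nat.add_sub_cancel]
  set D := Fintype.card ι with hD
  set Bad := (boxFinset b (r + (m + j))).filter fun f =>
    (Algebra.norm k[X] f).degree < (D * r : ℕ) with hBad
  have hshift : ∀ x ∈ polysLT k (r + j), algebraMap k[X] A x ∈ degreeBox k b (r + (m + j)) := by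
    intro x hx
    rw [mem_polysLT] at hx
    rw [mem_degreeBox] at hm ⊢
    intro i
    have hmi := hm i
    rw [Algebra.algebraMap_eq_smul_one, map_smul, Finsupp.smul_apply, smul_eq_mul, degree_mul]
    by_cases h0 : x = 0
    · simp [h0]
    by_cases h1 : b.repr 1 i = 0
    · simp [h1]
    rw [degree_eq_natDegree h0] at hx ⊢
    rw [degree_eq_natDegree h1] at hmi ⊢
    norm_cast at hx hmi ⊢
    omega
  -- The norm of x + f is the value at x of the characteristic polynomial of multiplication by −f,
  -- monic of degree D over k[X].
  have hcount : ∀ f ∈ boxFinset b (r + (m + j)),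
      ((polysLT k (r + j)).filter fun x => algebraMap k[X] A x + f ∈ Bad).card ≤
        D * Fintype.card k ^ r := by
    intro f _
    refine card_le_of_degree_eval_lt r D (Algebra.lmul k[X] A (-f)).charpoly
      (LinearMap.charpoly_monic _) ?_ _ fun x hx => ?_
    · rw [LinearMap.charpoly_natDegree, Module.finrank_eq_card_basis b]
    · rw [LinearMap.eval_charpoly]
      have := (Finset.mem_filter.1 (Finset.mem_filter.1 hx).2).2
      rw [Algebra.norm_apply] at this
      convert! this using 3
      ext y
      simp [Algebra.algebraMap_eq_smul_one]
  -- Double counting: each translation by x permutes the box, hence sees every bad element once.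
  have hdc : (polysLT k (r + j)).card * Bad.card =
      ∑ f ∈ boxFinset b (r + (m + j)),
        ((polysLT k (r + j)).filter fun x => algebraMap k[X] A x + f ∈ Bad).card := by
    have h := Finset.sum_card_bipartiteAbove_eq_sum_card_bipartiteBelow
      (fun (f : A) (x : k[X]) => algebraMap k[X] A x + f ∈ Bad) (s := boxFinset b (r + (m + j)))
      (t := polysLT k (r + j))
    unfold Finset.bipartiteAbove Finset.bipartiteBelow at h
    rw [h, ← smul_eq_mul, ← Finset.sum_const]
    refine Finset.sum_congr rfl fun x hx => ?_
    refine Finset.card_bij' (fun f _ => f - algebraMap k[X] A x)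
      (fun f _ => algebraMap k[X] A x + f) ?_ ?_ ?_ ?_
    · intro f hf
      refine Finset.mem_filter.2 ⟨(mem_boxFinset b).2 (sub_mem ?_ (hshift x hx)), by simpa using hf⟩
      exact (mem_boxFinset b).1 (Finset.mem_filter.1 hf).1
    · intro f hf
      exact (Finset.mem_filter.1 hf).2
    · intro f _; ring
    · intro f _; ring
  have h1 : Fintype.card k ^ (r + j) * Bad.card ≤
      Fintype.card k ^ ((r + (m + j)) * D) * (D * Fintype.card k ^ r) := by
    rw [← card_polysLT, hdc, ← card_boxFinset b, ← smul_eq_mul (a := (boxFinset b _).card)]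
    exact Finset.sum_le_card_nsmul _ _ _ hcount
  have hqr : 0 < Fintype.card k ^ r := by positivity
  have h2 : Fintype.card k ^ j * Bad.card ≤ Fintype.card k ^ ((r + (m + j)) * D) * D := by
    refine Nat.le_of_mul_le_mul_left ?_ hqr
    calc _ = Fintype.card k ^ (r + j) * Bad.card := by rw [pow_add]; ring
      _ ≤ _ := h1
      _ = _ := by ring
  have hDpos : 0 < D := Fintype.card_pos_iff.2 b.index_nonempty
  refine Nat.le_of_mul_le_mul_left ?_ hDpos
  calc D * (100 * Bad.card) = (100 * D) * Bad.card := by ring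
    _ ≤ Fintype.card k ^ j * Bad.card := Nat.mul_le_mul_right _ hj.le
    _ ≤ _ := h2
    _ = _ := by ring

end BoxNorm

/-! ### Equidistribution of ideals in function fields -/

section FunctionFieldCount

open Polynomial Submodule

universe u

variable {k : Type*} [Field k] [Fintype k] {A : Type u} [CommRing A] [IsDedekindDomain A] [Algebra k[X] A]
  [Algebra k A] [IsScalarTower k k[X] A] {ι : Type*} [Fintype ι]

/-- Scales of real numbers by powers of `q ^ D`. -/
theorem eventually_exists_pow_le {q : ℝ} (hq : 1 < q) {D : ℕ} (hD : 0 < D) (c N : ℕ) :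
    ∀ᶠ x : ℝ in atTop, ∃ n ≥ N, q ^ (n * D + c) ≤ x ∧ x ≤ q ^ (c + D) * q ^ (n * D) := by
  filter_upwards [eventually_ge_atTop (q ^ (N * D + c))] with x hx
  have hqD : 1 < q ^ D := one_lt_pow₀ hq hD.ne'
  have hc : 0 < q ^ (N * D + c) := by positivity
  obtain ⟨m, hm1, hm2⟩ := exists_nat_pow_near ((one_le_div hc).2 hx) hqD
  rw [le_div_iff₀ hc] at hm1
  rw [div_lt_iff₀ hc] at hm2
  refine ⟨N + m, by omega, ?_, ?_⟩
  · calc q ^ ((N + m) * D + c)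
      _ = (q ^ D) ^ m * q ^ (N * D + c) := by
        rw [← pow_mul, ← pow_add]; congr 1; ring
      _ ≤ x := hm1
  · calc x ≤ (q ^ D) ^ (m + 1) * q ^ (N * D + c) := hm2.le
      _ = q ^ (c + D) * q ^ ((N + m) * D) := by
        rw [← pow_mul, ← pow_add, ← pow_add]; congr 1; ring

/-- The family is the principal ideals of the nonzero elements of a box with q^(nD) comparable to x.
Q divides (f) exactly when f lies in the subspace Q, so the counts are powers of q minus one. -/
theorem equidistributedIdeals_of_basis (b : Module.Basis ι k[X] A) :
    EquidistributedIdeals A := by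
  classical
  have hfq := hasFiniteQuotients_of_basis b
  have hfin := Module.Finite.of_basis b
  have hfree := Module.Free.of_basis b
  set q : ℝ := ((Fintype.card k : ℕ) : ℝ) with hq
  have hq1 : 1 < q := by rw [hq]; exact_mod_cast Fintype.one_lt_card (α := k)
  have hq2 : 2 ≤ q := by rw [hq]; exact_mod_cast Fintype.one_lt_card (α := k)
  have hD : 0 < Fintype.card ι := Fintype.card_pos_iff.2 b.index_nonempty
  obtain ⟨c, hc⟩ := exists_cardQuot_span_le b
  obtain ⟨J, hJ⟩ := exists_card_filter_norm_lt b
  set D := Fintype.card ι with hDdef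
  set K := q ^ (c + D) with hK
  have hK1 : 1 ≤ K := one_le_pow₀ hq1.le
  have hNQ : ∀ Q : Ideal A, Q ≠ ⊥ → (cardQuot Q : ℝ) = q ^ Module.finrank k (A ⧸ Q) := by
    intro Q hQ
    have : Finite (A ⧸ Q) := Ring.HasFiniteQuotients.finiteQuotient hQ
    have : FiniteDimensional k (A ⧸ Q) := Module.Finite.of_finite
    rw [cardQuot_eq_pow_finrank (k := k)]
    push_cast
    rfl
  have hdim : ∀ Q : Ideal A, Q ≠ ⊥ → ∀ n, ∀ f ∈ degreeBox k b n, f ≠ 0 → f ∈ Q →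
      Module.finrank k (A ⧸ Q) ≤ n * D + c := by
    intro Q hQ n f hf hf0 hfQ
    have h1 : cardQuot Q ≤ cardQuot (Ideal.span {f}) := by
      have : Finite (A ⧸ Ideal.span {f}) :=
        Ring.HasFiniteQuotients.finiteQuotient (by simpa using hf0)
      have h : Nat.card (A ⧸ Q) ≤ Nat.card (A ⧸ Ideal.span {f}) :=
        Nat.card_le_card_of_surjective _ (Ideal.Quotient.factor_surjective
        ((Ideal.span_singleton_le_iff_mem Q).2 hfQ))
      exact h
    have h2 : (cardQuot Q : ℝ) ≤ q ^ (n * D + c) := by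
      rw [hq]
      exact_mod_cast h1.trans (hc n f hf hf0)
    rw [hNQ Q hQ] at h2
    exact (pow_le_pow_iff_right₀ hq1).1 h2
  have hev := eventually_exists_pow_le hq1 hD c (J + 1)
  have h5 := (tendsto_rpow_atTop (show (0 : ℝ) < 1 / 20 by norm_num)).eventually_ge_atTop
    (20 * K * q ^ (D * (c + D)))
  -- Large x makes the loss from K and from the degree defect J at most 1% of log x.
  have hl := Real.tendsto_log_atTop.eventually_ge_atTop
    (100 * (Real.log K + D * J * Real.log q))
  refine ⟨2 * K, ?_⟩
  filter_upwards [hev, h5, hl, eventually_gt_atTop 1] with x ⟨n, hnJ, hn1, hn2⟩ h5 hl hx1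
  have hx0 : 0 < x := by linarith
  set X' := q ^ (n * D) with hX'
  have hX2 : 2 ≤ X' := by
    calc (2 : ℝ) ≤ q := hq2
      _ = q ^ 1 := (pow_one q).symm
      _ ≤ X' := pow_le_pow_right₀ hq1.le (Nat.mul_pos (by omega) hD)
  have hcard : ((boxFinset b n).card : ℝ) = X' := by
    rw [card_boxFinset]; push_cast; rfl
  set s := (boxFinset b n).erase 0 with hs
  have h0mem : (0 : A) ∈ boxFinset b n := (mem_boxFinset b).2 (zero_mem _)
  have hscard : (s.card : ℝ) = X' - 1 := by
    rw [hs, Finset.card_erase_of_mem h0mem, Nat.cast_sub (Finset.card_pos.2 ⟨0, h0mem⟩), hcard,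
      Nat.cast_one]
  have hsmem : ∀ f ∈ s, f ≠ 0 ∧ f ∈ degreeBox k b n := by
    intro f hf
    obtain ⟨h1, h2⟩ := Finset.mem_erase.1 hf
    exact ⟨h1, (mem_boxFinset b).1 h2⟩
  refine ⟨A, s, fun f => Ideal.span {f}, ?_, fun f hf => ⟨?_, ?_⟩, ?_, fun Q hQ => ?_⟩
  · rw [← Finset.card_pos]
    have : (0 : ℝ) < s.card := by rw [hscard]; linarith
    exact_mod_cast this
  · simpa using (hsmem f hf).1
  · refine le_trans ?_ hn1
    rw [hq]
    exact_mod_cast hc n f (hsmem f hf).2 (hsmem f hf).1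
  · set Bad := (boxFinset b n).filter fun f =>
      (Algebra.norm k[X] f).degree < (D * (n - J) : ℕ) with hBad
    have hBadc : 100 * (Bad.card : ℝ) ≤ X' := by
      have := hJ n (by omega)
      rw [hX', hq]
      exact_mod_cast this
    set T := s \ Bad with hT
    have hTc : (s.card : ℝ) - Bad.card ≤ T.card := by
      have : s.card - Bad.card ≤ T.card := Finset.le_card_sdiff Bad s
      have h2 : s.card ≤ T.card + Bad.card := by omega
      have h3 : (s.card : ℝ) ≤ T.card + Bad.card := by exact_mod_cast h2
      linarith
    have hlx : Real.log x ≤ Real.log K + Real.log X' := by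
      rw [← Real.log_mul (by positivity) (by positivity)]
      exact Real.log_le_log hx0 hn2
    have hT1 : ∀ f ∈ T, 98 / 100 * Real.log x ≤ Real.log (cardQuot (Ideal.span {f})) := by
      intro f hf
      obtain ⟨hfs, hfB⟩ := Finset.mem_sdiff.1 hf
      have hf0 := (hsmem f hfs).1
      have hnorm : Algebra.norm k[X] f ≠ 0 := Algebra.norm_ne_zero_iff.2 hf0
      have hdeg : D * (n - J) ≤ (Algebra.norm k[X] f).natDegree := by
        by_contra! hlt
        refine hfB (Finset.mem_filter.2 ⟨(Finset.mem_erase.1 hfs).2, ?_⟩)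
        rw [degree_eq_natDegree hnorm]
        exact_mod_cast hlt
      have hN : (cardQuot (Ideal.span {f}) : ℝ) = q ^ (Algebra.norm k[X] f).natDegree := by
        have := cardQuot_span_eq_cardPowDegree b hf0
        rw [cardPowDegree_nonzero _ hnorm] at this
        rw [hq]
        exact_mod_cast this
      rw [hN, Real.log_pow]
      have hlq : 0 < Real.log q := Real.log_pos hq1
      have h1 : ((D * (n - J) : ℕ) : ℝ) ≤ (Algebra.norm k[X] f).natDegree := by
        exact_mod_cast hdeg
      rw [Nat.cast_mul, Nat.cast_sub (by omega)] at h1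
      have h2 := mul_le_mul_of_nonneg_right h1 hlq.le
      have h3 : Real.log X' = n * D * Real.log q := by
        rw [hX', Real.log_pow]; push_cast; ring
      nlinarith
    have h1 : (T.card : ℝ) * (98 / 100 * Real.log x) ≤
        ∑ f ∈ s, Real.log (cardQuot (Ideal.span {f})) := by
      rw [← nsmul_eq_mul]
      exact (Finset.card_nsmul_le_sum T (fun f => Real.log (cardQuot (Ideal.span {f}))) _
        hT1).trans (Finset.sum_le_sum_of_subset_of_nonneg Finset.sdiff_subset fun f _ _ =>
          Real.log_natCast_nonneg _)
    refine le_trans ?_ h1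
    have hlx0 : 0 < Real.log x := Real.log_pos hx1
    have h2 : 97 / 100 * (s.card : ℝ) ≤ T.card := by linarith
    nlinarith
  · have : Finite (A ⧸ Q) := Ring.HasFiniteQuotients.finiteQuotient hQ
    have : FiniteDimensional k (A ⧸ Q) := Module.Finite.of_finite
    obtain ⟨d1, d2⟩ := finrank_degreeBox_inf_eq (b := b) (hdim Q hQ)
    replace d1 := d1 n
    replace d2 := d2 n
    set δ := Module.finrank k (A ⧸ Q) with hδ
    set h := Module.finrank k (degreeBox k b n ⊓ Q.restrictScalars k : Submodule k A) with hh
    have hcnt : ((s.filter fun f => Q ∣ Ideal.span {f}).card : ℝ) = q ^ h - 1 := by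
      have e : s.filter (fun f => Q ∣ Ideal.span {f}) =
          ((boxFinset b n).filter (· ∈ Q)).erase 0 := by
        ext f
        simp only [hs, Finset.mem_filter, Finset.mem_erase, Ideal.dvd_span_singleton]
        tauto
      have hm : (0 : A) ∈ (boxFinset b n).filter (· ∈ Q) :=
        Finset.mem_filter.2 ⟨h0mem, zero_mem _⟩
      rw [e, Finset.card_erase_of_mem hm, Nat.cast_sub (Finset.card_pos.2 ⟨0, hm⟩),
        card_filter_boxFinset]
      push_cast
      rfl
    rw [hcnt, hNQ Q hQ, hscard]
    -- For such Q the box is large enough for the exact dimension nD − δ, and discarding 0 costs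
    -- only q^δ ≤ X'/20.
    have hsmall : q ^ δ ≤ x ^ (19 / 20 : ℝ) →
        q ^ δ * (q ^ h - 1) = X' - q ^ δ ∧ 20 * q ^ δ ≤ X' := by
      intro hle
      have e : x = x ^ (19 / 20 : ℝ) * x ^ (1 / 20 : ℝ) := by
        rw [← Real.rpow_add hx0]; norm_num
      have h1 : q ^ δ * (20 * K * q ^ (D * (c + D))) ≤ x := by
        rw [e]
        exact mul_le_mul hle h5 (by positivity) (by positivity)
      have h2 : 20 * (q ^ δ * q ^ (D * (c + D))) ≤ X' := by
        have : K * (20 * (q ^ δ * q ^ (D * (c + D)))) ≤ K * X' := by linarith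
        exact le_of_mul_le_mul_left this (by linarith)
      have hp : 0 < q ^ δ * q ^ (D * (c + D)) := by positivity
      have h3 : δ + D * (c + D) ≤ n * D := by
        rw [← pow_le_pow_iff_right₀ hq1, pow_add]
        linarith
      have h4 := d2 h3
      refine ⟨?_, ?_⟩
      · rw [mul_sub, ← pow_add, add_comm δ, h4, mul_one]
      · have : 1 ≤ q ^ (D * (c + D)) := one_le_pow₀ hq1.le
        have : 0 < q ^ δ := by positivity
        nlinarith
    have hone : 1 ≤ q ^ δ := one_le_pow₀ hq1.le
    refine ⟨fun hle => ?_, fun hle => ?_, fun hle => ?_⟩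
    · obtain ⟨h1, h2⟩ := hsmall hle
      rw [h1]; linarith
    · obtain ⟨h1, h2⟩ := hsmall (hle.trans
        (Real.rpow_le_rpow_of_exponent_le hx1.le (by norm_num)))
      rw [h1]; linarith
    · rcases d1 with d1 | d1
      · have : h = 0 := by rw [hh, d1, finrank_bot]
        rw [this]
        simp only [pow_zero, sub_self, mul_zero]
        have : 0 < K := by linarith
        have : 0 < X' - 1 := by linarith
        positivity
      · have hh1 : 1 ≤ q ^ h := one_le_pow₀ hq1.le
        calc x ^ (3 / 4 : ℝ) * (q ^ h - 1) ≤ q ^ δ * (q ^ h - 1) :=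
              mul_le_mul_of_nonneg_right hle (by linarith)
          _ ≤ q ^ δ * q ^ h := by nlinarith
          _ = q ^ (h + δ) := by rw [← pow_add, add_comm]
          _ ≤ q ^ (n * D + c + D) := pow_le_pow_right₀ hq1.le d1
          _ = K * X' := by rw [hK, hX', ← pow_add]; congr 1; ring
          _ ≤ 2 * K * (X' - 1) := by nlinarith

end FunctionFieldCount

/-! ### Sizes of elements and primes containing them -/

section SizeFunction

open Submodule

/-- A submultiplicative size function on `A` that bounds the norms of principal ideals. -/
structure IdealSize (A : Type*) [CommRing A] where
  /-- The size. -/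
  toFun : A → ℝ
  nonneg : ∀ a, 0 ≤ toFun a
  add_le : ∀ a b, toFun (a + b) ≤ toFun a + toFun b
  mul_le : ∀ a b, toFun (a * b) ≤ toFun a * toFun b
  neg_eq : ∀ a, toFun (-a) = toFun a
  /-- The factor in the bound for the norms. -/
  factor : ℝ
  /-- The exponent in the bound for the norms. -/
  exponent : ℕ
  cardQuot_le : ∀ a, a ≠ 0 → (cardQuot (Ideal.span {a}) : ℝ) ≤ factor * toFun a ^ exponent

namespace IdealSize

/-- The sum of the absolute values of the entries of the multiplication matrices. -/
noncomputable def ofBasis {B A ι : Type*} [CommRing B] [Nontrivial B] [CommRing A] [Algebra B A] [Fintype ι]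
    [DecidableEq ι] (abv : AbsoluteValue B ℤ) (b : Module.Basis ι B A)
    (h : ∀ a : A, a ≠ 0 → (cardQuot (Ideal.span {a}) : ℤ) ≤ abv (Algebra.norm B a)) :
    IdealSize A where
  toFun a := ((∑ i, ∑ j, abv (Algebra.leftMulMatrix b a i j) : ℤ) : ℝ)
  nonneg a := Int.cast_nonneg (Finset.sum_nonneg fun i _ => Finset.sum_nonneg fun j _ =>
    abv.nonneg _)
  add_le a a' := by
    norm_cast
    simp_rw [map_add, Matrix.add_apply, ← Finset.sum_add_distrib]
    exact Finset.sum_le_sum fun i _ => Finset.sum_le_sum fun j _ => abv.add_le _ _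
  mul_le a a' := by
    norm_cast
    simp_rw [map_mul, Matrix.mul_apply]
    set M := Algebra.leftMulMatrix b a
    set M' := Algebra.leftMulMatrix b a'
    rw [Finset.sum_mul]
    refine Finset.sum_le_sum fun i _ => ?_
    calc ∑ j, abv (∑ l, M i l * M' l j) ≤ ∑ j, ∑ l, abv (M i l) * abv (M' l j) :=
          Finset.sum_le_sum fun j _ => (abv.sum_le _ _).trans_eq
            (Finset.sum_congr rfl fun l _ => abv.map_mul _ _)
      _ = ∑ l, abv (M i l) * ∑ j, abv (M' l j) := by
          rw [Finset.sum_comm]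
          simp_rw [Finset.mul_sum]
      _ ≤ ∑ l, abv (M i l) * ∑ i, ∑ j, abv (M' i j) := by
          refine Finset.sum_le_sum fun l _ => mul_le_mul_of_nonneg_left ?_ (abv.nonneg _)
          exact Finset.single_le_sum (f := fun i => ∑ j, abv (M' i j))
            (fun i _ => Finset.sum_nonneg fun j _ => abv.nonneg _) (Finset.mem_univ l)
      _ = (∑ l, abv (M i l)) * ∑ i, ∑ j, abv (M' i j) := by rw [Finset.sum_mul]
  neg_eq a := by simp
  -- The norm is a determinant: D! products of D entries, each entry at most the size.
  factor := (Fintype.card ι).factorial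
  exponent := Fintype.card ι
  cardQuot_le a ha := by
    have h1 := h a ha
    rw [Algebra.norm_eq_matrix_det b] at h1
    have h2 := Matrix.det_le (A := Algebra.leftMulMatrix b a) (abv := abv)
      (x := ∑ i, ∑ j, abv (Algebra.leftMulMatrix b a i j)) fun i j =>
        (Finset.single_le_sum (f := fun j => abv (Algebra.leftMulMatrix b a i j))
          (fun j _ => abv.nonneg _) (Finset.mem_univ j)).trans
        (Finset.single_le_sum (f := fun i => ∑ j, abv (Algebra.leftMulMatrix b a i j))
          (fun i _ => Finset.sum_nonneg fun j _ => abv.nonneg _) (Finset.mem_univ i))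
    have h3 := h1.trans h2
    rw [nsmul_eq_mul] at h3
    exact_mod_cast h3

variable {A : Type*} [CommRing A] (s : IdealSize A)

/-- The sum of the sizes of the entries of a matrix. -/
noncomputable def matrixSize {d : ℕ} (M : Matrix (Fin d) (Fin d) A) : ℝ :=
  ∑ i, ∑ j, s.toFun (M i j)

theorem matrixSize_nonneg {d : ℕ} (M : Matrix (Fin d) (Fin d) A) : 0 ≤ s.matrixSize M :=
  Finset.sum_nonneg fun _ _ => Finset.sum_nonneg fun _ _ => s.nonneg _

theorem le_matrixSize {d : ℕ} (M : Matrix (Fin d) (Fin d) A) (i j : Fin d) :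
    s.toFun (M i j) ≤ s.matrixSize M :=
  (Finset.single_le_sum (f := fun j => s.toFun (M i j)) (fun _ _ => s.nonneg _)
    (Finset.mem_univ j)).trans (Finset.single_le_sum (f := fun i => ∑ j, s.toFun (M i j))
      (fun _ _ => Finset.sum_nonneg fun _ _ => s.nonneg _) (Finset.mem_univ i))

theorem sum_le {κ : Type*} {t : Finset κ} (ht : t.Nonempty) (f : κ → A) :
    s.toFun (∑ i ∈ t, f i) ≤ ∑ i ∈ t, s.toFun (f i) := by
  induction ht using Finset.Nonempty.cons_induction with
  | singleton a => simp
  | cons a t ha ht ih =>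
    rw [Finset.sum_cons, Finset.sum_cons]
    exact (s.add_le _ _).trans (add_le_add le_rfl ih)

theorem matrixSize_mul_le {d : ℕ} (M M' : Matrix (Fin d) (Fin d) A) :
    s.matrixSize (M * M') ≤ s.matrixSize M * s.matrixSize M' := by
  unfold matrixSize
  rw [Finset.sum_mul]
  refine Finset.sum_le_sum fun i _ => ?_
  calc ∑ j, s.toFun ((M * M') i j) ≤ ∑ j, ∑ l, s.toFun (M i l) * s.toFun (M' l j) :=
        Finset.sum_le_sum fun j _ => (s.sum_le ⟨i, Finset.mem_univ i⟩ _).trans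
          (Finset.sum_le_sum fun l _ => s.mul_le _ _)
    _ = ∑ l, s.toFun (M i l) * ∑ j, s.toFun (M' l j) := by
        rw [Finset.sum_comm]
        simp_rw [Finset.mul_sum]
    _ ≤ ∑ l, s.toFun (M i l) * ∑ i, ∑ j, s.toFun (M' i j) := by
        refine Finset.sum_le_sum fun l _ => mul_le_mul_of_nonneg_left ?_ (s.nonneg _)
        exact Finset.single_le_sum (f := fun i => ∑ j, s.toFun (M' i j))
          (fun i _ => Finset.sum_nonneg fun j _ => s.nonneg _) (Finset.mem_univ l)
    _ = (∑ l, s.toFun (M i l)) * ∑ i, ∑ j, s.toFun (M' i j) := by rw [Finset.sum_mul]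

/-- Products of `n` matrices from a finite set have a common denominator `t ^ n` and numerators of
size exponential in `n`. -/
theorem exists_numerators [IsDomain A] {K : Type*} [Field K] [Algebra A K] [IsFractionRing A K]
    {d : ℕ} {E : Set (Matrix (Fin d) (Fin d) K)} (hE : E.Finite) :
    ∃ t : A, t ≠ 0 ∧ ∃ L₀ L : ℝ, 1 ≤ L₀ ∧ 1 ≤ L ∧ ∀ n : ℕ, ∀ M ∈ E ^ n,
      ∃ N : Matrix (Fin d) (Fin d) A,
        N.map (algebraMap A K) = algebraMap A K (t ^ n) • M ∧ ∀ i j, s.toFun (N i j) ≤ L₀ * L ^ n := by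
  classical
  obtain ⟨⟨t, ht⟩, hden⟩ := IsLocalization.exist_integer_multiples (nonZeroDivisors A)
    (hE.toFinset ×ˢ (Finset.univ : Finset (Fin d × Fin d))) fun p => p.1 p.2.1 p.2.2
  have ht0 : t ≠ 0 := nonZeroDivisors.ne_zero ht
  have hnum : ∀ M ∈ E, ∃ N : Matrix (Fin d) (Fin d) A,
      N.map (algebraMap A K) = algebraMap A K t • M := by
    intro M hM
    have : ∀ i j, ∃ a, algebraMap A K a = t • M i j := fun i j =>
      hden (M, i, j) (Finset.mem_product.2 ⟨hE.mem_toFinset.2 hM, Finset.mem_univ _⟩)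
    choose N hN using this
    refine ⟨Matrix.of N, ?_⟩
    ext i j
    rw [Matrix.map_apply, Matrix.of_apply, hN, Matrix.smul_apply, smul_eq_mul, Algebra.smul_def]
  choose! num hnum using hnum
  -- L₀ pays for the empty product, the identity matrix; L bounds the numerator of each further
  -- factor.
  refine ⟨t, ht0, 1 + s.matrixSize (1 : Matrix (Fin d) (Fin d) A),
    1 + ∑ M ∈ hE.toFinset, s.matrixSize (num M), by linarith [s.matrixSize_nonneg (d := d) 1],
    by linarith [Finset.sum_nonneg fun M (_ : M ∈ hE.toFinset) => s.matrixSize_nonneg (num M)],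
    ?_⟩
  set L₀ := 1 + s.matrixSize (1 : Matrix (Fin d) (Fin d) A)
  set L := 1 + ∑ M ∈ hE.toFinset, s.matrixSize (num M)
  have key : ∀ n : ℕ, ∀ M ∈ E ^ n, ∃ N : Matrix (Fin d) (Fin d) A,
      N.map (algebraMap A K) = algebraMap A K (t ^ n) • M ∧ s.matrixSize N ≤ L₀ * L ^ n := by
    intro n
    induction n with
    | zero =>
      intro M hM
      rw [pow_zero, Set.mem_one] at hM
      refine ⟨1, by simp [hM], by simp [L₀]⟩
    | succ n ih =>
      intro M hM
      rw [pow_succ, Set.mem_mul] at hM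
      obtain ⟨M₁, hM₁, M₂, hM₂, rfl⟩ := hM
      obtain ⟨N, hN, hNs⟩ := ih M₁ hM₁
      refine ⟨N * num M₂, ?_, (s.matrixSize_mul_le _ _).trans ?_⟩
      · rw [Matrix.map_mul, hN, hnum M₂ hM₂, Matrix.smul_mul, Matrix.mul_smul, smul_smul, pow_succ,
          map_mul]
      · rw [pow_succ, ← mul_assoc]
        refine mul_le_mul hNs ?_ (s.matrixSize_nonneg _) ((s.matrixSize_nonneg _).trans hNs)
        have := Finset.single_le_sum (f := fun M => s.matrixSize (num M))
          (fun M _ => s.matrixSize_nonneg _) (hE.mem_toFinset.2 hM₂)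
        simp only [L]
        linarith
  intro n M hM
  obtain ⟨N, hN, hNs⟩ := key n M hM
  exact ⟨N, hN, fun i j => (s.le_matrixSize N i j).trans hNs⟩

end IdealSize

/-- An element of small norm lies in few primes of large norm. -/
theorem ncard_primes_mul_log_le {A : Type*} [CommRing A] [IsDedekindDomain A]
    [Ring.HasFiniteQuotients A] [Infinite A] {a : A} (ha : a ≠ 0) {z : ℝ} (hz : 1 ≤ z) :
    {P : Ideal A | P.IsPrime ∧ P ≠ ⊥ ∧ z ≤ cardQuot P ∧ a ∈ P}.Finite ∧
    ({P : Ideal A | P.IsPrime ∧ P ≠ ⊥ ∧ z ≤ cardQuot P ∧ a ∈ P}.ncard : ℝ) * Real.log z ≤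
      Real.log (cardQuot (Ideal.span {a})) := by
  have hfin : {P : Ideal A | P.IsPrime ∧ P ≠ ⊥ ∧ z ≤ cardQuot P ∧ a ∈ P}.Finite :=
    (Ring.HasFiniteQuotients.finite_setOfPred_mem a ha).subset fun P hP => hP.2.2.2
  refine ⟨hfin, ?_⟩
  set F := hfin.toFinset with hF
  have hmem : ∀ P ∈ F, P.IsPrime ∧ P ≠ ⊥ ∧ z ≤ cardQuot P ∧ a ∈ P := fun P hP => by
    simpa [hF] using hP
  have hspan : Ideal.span {a} ≠ ⊥ := by simpa using ha
  -- Distinct primes containing a multiply to a divisor of (a), so z to their number is at most the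
  -- norm of (a).
  have hdvd : ∏ P ∈ F, P ∣ Ideal.span {a} := Finset.prod_primes_dvd _
    (fun P hP => Ideal.prime_of_isPrime (hmem P hP).2.1 (hmem P hP).1)
    fun P hP => Ideal.dvd_span_singleton.2 (hmem P hP).2.2.2
  have h1 := cardQuot_le_of_dvd hspan hdvd
  rw [← cardQuotHom_apply, map_prod] at h1
  have h2 : z ^ F.card ≤ (cardQuot (Ideal.span {a}) : ℝ) := by
    calc z ^ F.card = ∏ _P ∈ F, z := by rw [Finset.prod_const]
      _ ≤ ∏ P ∈ F, (cardQuot P : ℝ) := Finset.prod_le_prod (fun _ _ => by linarith)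
          fun P hP => (hmem P hP).2.2.1
      _ ≤ _ := by exact_mod_cast h1
  rw [Set.ncard_eq_toFinset_card _ hfin, ← Real.log_pow]
  exact Real.log_le_log (by positivity) h2

end SizeFunction

/-! ### Primes of overrings of a Dedekind domain -/

section Overring

open Submodule IsDedekindDomain

variable {A K : Type*} [CommRing A] [IsDedekindDomain A] [Field K] [Algebra A K]
  [IsFractionRing A K] {R : Subring K} (hAR : ∀ a, algebraMap A K a ∈ R)

/-- The inclusion of `A` in an overring contained in the fraction field. -/
def toOverring : A →+* R := (algebraMap A K).codRestrict R hAR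

theorem coe_toOverring (a : A) : (toOverring hAR a : K) = algebraMap A K a := rfl

/-- The numerator of a nonzero element of P is a nonzero element of the contraction. -/
theorem comap_toOverring_ne_bot (P : Ideal R) (h0 : P ≠ ⊥) : P.comap (toOverring hAR) ≠ ⊥ := by
  obtain ⟨x, hx, hx0⟩ := P.ne_bot_iff.1 h0
  obtain ⟨c, e, he, hxe⟩ := IsFractionRing.div_surjective (A := A) (x : K)
  have he0 : algebraMap A K e ≠ 0 :=
    IsFractionRing.to_map_ne_zero_of_mem_nonZeroDivisors he
  have h1 : toOverring hAR c = x * toOverring hAR e := Subtype.ext (by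
    rw [Subring.coe_mul, coe_toOverring, coe_toOverring, ← hxe, div_mul_cancel₀ _ he0])
  refine (Submodule.ne_bot_iff _).2 ⟨c, ?_, ?_⟩
  · rw [Ideal.mem_comap, h1]
    exact P.mul_mem_right _ hx
  · rintro rfl
    rw [map_zero, zero_div] at hxe
    exact hx0 (Subtype.ext (by rw [← hxe]; rfl))

/-- The localization of A at the contraction p is a valuation ring, so x or its inverse has a
denominator outside p. In the second case x·a = b with b ∉ P forces a ∉ P. Thus R lies in A_p. -/
theorem exists_mul_eq_of_comap (P : Ideal R) [hP : P.IsPrime] (h0 : P ≠ ⊥) (x : R) :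
    ∃ a b : A, toOverring hAR b ∉ P ∧ x * toOverring hAR b = toOverring hAR a := by
  let v : HeightOneSpectrum A :=
    ⟨P.comap (toOverring hAR), inferInstance, comap_toOverring_ne_bot hAR P h0⟩
  obtain ⟨a, ⟨b, hb⟩, h | h⟩ := v.exists_primeCompl_mul_eq_or_mul_eq (x : K)
  · exact ⟨a, b, hb, Subtype.ext h⟩
  · have h' : x * toOverring hAR a = toOverring hAR b := Subtype.ext h
    refine ⟨b, a, fun ha => hb ?_, h'⟩
    change toOverring hAR b ∈ P
    rw [← h']
    exact P.mul_mem_left _ ha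

theorem comap_toOverring_le_iff (P P' : Ideal R) [hP : P.IsPrime] (h0 : P ≠ ⊥)
    (h : P.comap (toOverring hAR) ≤ P'.comap (toOverring hAR))
    (h' : P'.comap (toOverring hAR) ≤ P.comap (toOverring hAR)) [hP' : P'.IsPrime] :
    P ≤ P' := by
  intro x hx
  obtain ⟨a, b, hb, hab⟩ := exists_mul_eq_of_comap hAR P h0 x
  have ha : toOverring hAR a ∈ P' := h (by rw [Ideal.mem_comap, ← hab]; exact P.mul_mem_right _ hx)
  rw [← hab] at ha
  exact (hP'.mem_or_mem ha).resolve_right fun hb' => hb (h' hb')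

theorem comap_toOverring_injective {P P' : Ideal R} (hP : P.IsPrime) (h0 : P ≠ ⊥)
    (hP' : P'.IsPrime) (h0' : P' ≠ ⊥)
    (h : P.comap (toOverring hAR) = P'.comap (toOverring hAR)) : P = P' :=
  le_antisymm (comap_toOverring_le_iff hAR P P' h0 h.le h.ge)
    (comap_toOverring_le_iff hAR P' P h0' h.ge h.le)

/-- Writing x = a/b with b outside the contraction, b is invertible modulo that maximal ideal, so
every residue of R comes from A. -/
theorem cardQuot_comap_toOverring (P : Ideal R) (hP : P.IsPrime) (h0 : P ≠ ⊥) :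
    cardQuot (P.comap (toOverring hAR)) = cardQuot P := by
  have hmax : (P.comap (toOverring hAR)).IsMaximal :=
    Ideal.IsPrime.isMaximal inferInstance (comap_toOverring_ne_bot hAR P h0)
  suffices h : Function.Surjective (Ideal.quotientMap P (toOverring hAR) le_rfl) from
    Nat.card_congr (Equiv.ofBijective _ ⟨Ideal.quotientMap_injective, h⟩)
  intro y
  obtain ⟨x, rfl⟩ := Ideal.Quotient.mk_surjective y
  obtain ⟨a, b, hb, hab⟩ := exists_mul_eq_of_comap hAR P h0 x
  obtain ⟨c, i, hi, hc⟩ := hmax.exists_inv (x := b) hb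
  refine ⟨Ideal.Quotient.mk _ (a * c), ?_⟩
  rw [Ideal.quotientMap_mk, Ideal.Quotient.eq, map_mul, ← hab]
  have h1 : toOverring hAR c * toOverring hAR b = 1 - toOverring hAR i := by
    rw [← map_mul, ← map_one (toOverring hAR), ← map_sub, ← hc, add_sub_cancel_right]
  have h2 : x * toOverring hAR b * toOverring hAR c - x = -(x * toOverring hAR i) := by
    rw [mul_assoc, mul_comm (toOverring hAR b), h1]; ring
  rw [h2]
  exact P.neg_mem (P.mul_mem_left _ hi)

/-- The assumption `hR` says that R lies in A_p; the prime is R ∩ pA_p. -/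
theorem exists_comap_toOverring_eq {p : Ideal A} (hp : p.IsPrime) (h0 : p ≠ ⊥)
    (hR : ∀ x ∈ R, ∃ a b : A, b ∉ p ∧ x * algebraMap A K b = algebraMap A K a) :
    ∃ P : Ideal R, P.IsPrime ∧ P ≠ ⊥ ∧ P.comap (toOverring hAR) = p := by
  have hinj : Function.Injective (algebraMap A K) := IsFractionRing.injective A K
  let P : Ideal R :=
    { carrier := {x | ∃ a b : A, a ∈ p ∧ b ∉ p ∧ (x : K) * algebraMap A K b = algebraMap A K a}
      add_mem' := by
        rintro x y ⟨a, b, ha, hb, h⟩ ⟨a', b', ha', hb', h'⟩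
        refine ⟨a * b' + a' * b, b * b', p.add_mem (p.mul_mem_right _ ha) (p.mul_mem_right _ ha'),
          fun hbb => (hp.mem_or_mem hbb).elim hb hb', ?_⟩
        rw [map_add, map_mul, map_mul, map_mul, ← h, ← h', Subring.coe_add]
        ring
      zero_mem' := ⟨0, 1, p.zero_mem, fun h => hp.ne_top ((Ideal.eq_top_iff_one _).2 h), by simp⟩
      smul_mem' := by
        rintro c x ⟨a, b, ha, hb, h⟩
        obtain ⟨a', b', hb', h'⟩ := hR c c.2
        refine ⟨a' * a, b' * b, p.mul_mem_left _ ha, fun hbb => (hp.mem_or_mem hbb).elim hb' hb, ?_⟩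
        rw [map_mul, map_mul, ← h, ← h', smul_eq_mul, Subring.coe_mul]
        ring }
  have hmem : ∀ x : R, x ∈ P ↔ ∃ a b : A, a ∈ p ∧ b ∉ p ∧
      (x : K) * algebraMap A K b = algebraMap A K a := fun x => Iff.rfl
  have hcomap : P.comap (toOverring hAR) = p := by
    ext c
    rw [Ideal.mem_comap, hmem]
    constructor
    · rintro ⟨a, b, ha, hb, h⟩
      rw [coe_toOverring, ← map_mul] at h
      have := hinj h
      exact (hp.mem_or_mem (this ▸ ha)).resolve_right hb
    · intro hc
      exact ⟨c, 1, hc, fun h => hp.ne_top ((Ideal.eq_top_iff_one _).2 h), by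
        rw [coe_toOverring, map_one, mul_one]⟩
  refine ⟨P, ⟨fun h => ?_, ?_⟩, fun h => ?_, hcomap⟩
  · exact hp.ne_top (by rw [← hcomap, h, Ideal.comap_top])
  · rintro x y ⟨a'', b'', ha'', hb'', h''⟩
    obtain ⟨a, b, hb, h⟩ := hR x x.2
    obtain ⟨a', b', hb', h'⟩ := hR y y.2
    have e : a * a' * b'' = a'' * (b * b') := hinj (by
      rw [map_mul, map_mul, map_mul, map_mul, ← h, ← h', ← h'', Subring.coe_mul]; ring)
    have h1 : a * a' * b'' ∈ p := e ▸ p.mul_mem_right _ ha''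
    rcases hp.mem_or_mem ((hp.mem_or_mem h1).resolve_right hb'') with h2 | h2
    · exact Or.inl ⟨a, b, h2, hb, h⟩
    · exact Or.inr ⟨a', b', h2, hb', h'⟩
  · obtain ⟨c, hc, hc0⟩ := p.ne_bot_iff.1 h0
    rw [← hcomap, Ideal.mem_comap, h, Submodule.mem_bot] at hc
    exact hc0 (hinj (by rw [map_zero, ← coe_toOverring hAR, hc]; rfl))

end Overring

/-! ### Counting bad primes and the limit -/

section Counting

open Submodule

universe u

variable {A : Type u} {K : Type*} [CommRing A] [IsDedekindDomain A] [Ring.HasFiniteQuotients A]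
  [Infinite A] [Field K] [Algebra A K] [IsFractionRing A K] {R : Subring K}

theorem primesInInterval_overring_finite (hAR : ∀ a, algebraMap A K a ∈ R) (x y : ℝ) :
    (primesInInterval R x y).Finite := by
  refine Set.Finite.of_finite_image ((primesInInterval_finite (A := A) x y).subset
    (t := (fun P => P.comap (toOverring hAR)) '' primesInInterval R x y) ?_) ?_
  · rintro _ ⟨P, ⟨hP, h0, hx, hy⟩, rfl⟩
    have h := cardQuot_comap_toOverring hAR P hP h0
    refine ⟨inferInstance, comap_toOverring_ne_bot hAR P h0, ?_, ?_⟩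
    · change x ≤ (cardQuot (P.comap (toOverring hAR)) : ℝ)
      rw [h]; exact hx
    · change (cardQuot (P.comap (toOverring hAR)) : ℝ) ≤ y
      rw [h]; exact hy
  · rintro P ⟨hP, h0, -, -⟩ P' ⟨hP', h0', -, -⟩ h
    exact comap_toOverring_injective hAR hP h0 hP' h0' h

/-- The primes of `A` at which some element of `R` is not integral. -/
def nonintegralPrimes (A : Type u) [CommRing A] {K : Type*} [Field K] [Algebra A K]
    (R : Subring K) : Set (Ideal A) :=
  {p | p.IsPrime ∧ p ≠ ⊥ ∧
    ¬ ∀ x ∈ R, ∃ a b : A, b ∉ p ∧ x * algebraMap A K b = algebraMap A K a}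

/-- Every prime of A at which R is integral is the contraction of a prime of R of the same norm. -/
theorem ncard_primesInInterval_le_overring (hAR : ∀ a, algebraMap A K a ∈ R)
    (hT : (nonintegralPrimes A R).Finite) (x y : ℝ) :
    (primesInInterval A x y).ncard ≤
      (primesInInterval R x y).ncard + (nonintegralPrimes A R).ncard := by
  have hfin := primesInInterval_overring_finite hAR x y
  have hsub : primesInInterval A x y ⊆
      ((fun P => P.comap (toOverring hAR)) '' primesInInterval R x y) ∪ nonintegralPrimes A R := by
    rintro p ⟨hp, h0, hx, hy⟩
    by_cases hpT : p ∈ nonintegralPrimes A R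
    · exact Or.inr hpT
    · have : ∀ x ∈ R, ∃ a b : A, b ∉ p ∧ x * algebraMap A K b = algebraMap A K a := by
        by_contra hne
        exact hpT ⟨hp, h0, hne⟩
      obtain ⟨P, hP, h0', rfl⟩ := exists_comap_toOverring_eq hAR hp h0 this
      have h := cardQuot_comap_toOverring hAR P hP h0'
      refine Or.inl ⟨P, ⟨hP, h0', ?_, ?_⟩, rfl⟩
      · change x ≤ (cardQuot P : ℝ)
        rw [← h]; exact hx
      · change (cardQuot P : ℝ) ≤ y
        rw [← h]; exact hy
  refine (Set.ncard_le_ncard hsub ((hfin.image _).union hT)).trans ((Set.ncard_union_le _ _).trans ?_)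
  exact Nat.add_le_add_right (Set.ncard_image_le hfin) _

theorem finite_set_pow {M : Type*} [Monoid M] {s : Set M} (hs : s.Finite) (n : ℕ) :
    (s ^ n).Finite := by
  induction n with
  | zero => rw [pow_zero]; exact Set.finite_one
  | succ n ih => rw [pow_succ]; exact ih.mul hs

/-- The matrix over `K` underlying an element of `GL_d(R)`. -/
def coeMatrixHom (R : Subring K) (d : ℕ) :
    Matrix.GeneralLinearGroup (Fin d) R →* Matrix (Fin d) (Fin d) K :=
  (RingHom.toMonoidHom (R.subtype.mapMatrix (m := Fin d))).comp
    (Units.coeHom _)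

/-- Entries of differences of elements of `W ^ n` lie in boundedly many primes of norm at least
`exp (β * n)`. -/
theorem exists_ncard_primes_le (s : IdealSize A) (hAR : ∀ a, algebraMap A K a ∈ R) {d : ℕ}
    {W : Set (Matrix.GeneralLinearGroup (Fin d) R)} (hW : W.Finite) {β : ℝ} (hβ : 0 < β) :
    ∃ κ : ℝ, ∀ n : ℕ, 1 ≤ n → ∀ x ∈ W ^ n, ∀ y ∈ W ^ n, ∀ i j,
      x.1 i j - y.1 i j ≠ 0 →
      {P : Ideal R | P.IsPrime ∧ P ≠ ⊥ ∧ Real.exp (β * n) ≤ cardQuot P ∧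
        x.1 i j - y.1 i j ∈ P}.Finite ∧
      ({P : Ideal R | P.IsPrime ∧ P ≠ ⊥ ∧ Real.exp (β * n) ≤ cardQuot P ∧
        x.1 i j - y.1 i j ∈ P}.ncard : ℝ) ≤ κ := by
  have hinj : Function.Injective (algebraMap A K) := IsFractionRing.injective A K
  obtain ⟨t, ht, L₀, L, hL₀, hL, hnum⟩ :=
    s.exists_numerators (K := K) (hW.image (coeMatrixHom R d))
  set F := max s.factor 1 with hF
  have hF1 : 1 ≤ F := le_max_right _ _
  have hlF : 0 ≤ Real.log F := Real.log_nonneg hF1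
  have hlL₀ : 0 ≤ Real.log (2 * L₀) := Real.log_nonneg (by linarith)
  have hlL : 0 ≤ Real.log L := Real.log_nonneg hL
  -- The logarithm of the norm of t^n(x_ij − y_ij) is at most κβn, and each prime containing it uses
  -- at least βn.
  refine ⟨(Real.log F + s.exponent * (Real.log (2 * L₀) + Real.log L)) / β, ?_⟩
  intro n hn x hx y hy i j hxy
  have hmem : ∀ z ∈ W ^ n, coeMatrixHom R d z ∈ (coeMatrixHom R d '' W) ^ n := by
    intro z hz
    rw [← Set.image_pow]
    exact ⟨z, hz, rfl⟩
  obtain ⟨X, hX, hXs⟩ := hnum n _ (hmem x hx)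
  obtain ⟨Y, hY, hYs⟩ := hnum n _ (hmem y hy)
  set a := X i j - Y i j with ha
  have hr : toOverring hAR a = toOverring hAR (t ^ n) * (x.1 i j - y.1 i j) := by
    apply Subtype.ext
    have h1 := congrFun (congrFun hX i) j
    have h2 := congrFun (congrFun hY i) j
    rw [Matrix.map_apply, Matrix.smul_apply, smul_eq_mul] at h1 h2
    rw [Subring.coe_mul, coe_toOverring, coe_toOverring, ha, map_sub, h1, h2, AddSubgroupClass.coe_sub,
      mul_sub]
    rfl
  have ha0 : a ≠ 0 := by
    intro h
    rw [h, map_zero] at hr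
    rcases mul_eq_zero.1 hr.symm with h1 | h1
    · have h2 : algebraMap A K (t ^ n) = 0 := congrArg Subtype.val h1
      rw [← map_zero (algebraMap A K)] at h2
      exact pow_ne_zero n ht (hinj h2)
    · exact hxy h1
  have hsa : s.toFun a ≤ 2 * L₀ * L ^ n := by
    rw [ha, sub_eq_add_neg]
    refine (s.add_le _ _).trans ?_
    rw [s.neg_eq]
    linarith [hXs i j, hYs i j]
  have hz : 1 ≤ Real.exp (β * n) := Real.one_le_exp (by positivity)
  obtain ⟨hfin, hcount⟩ := ncard_primes_mul_log_le ha0 hz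
  have hmaps : ∀ P ∈ {P : Ideal R | P.IsPrime ∧ P ≠ ⊥ ∧ Real.exp (β * n) ≤ cardQuot P ∧
      x.1 i j - y.1 i j ∈ P}, P.comap (toOverring hAR) ∈
      {P : Ideal A | P.IsPrime ∧ P ≠ ⊥ ∧ Real.exp (β * n) ≤ cardQuot P ∧ a ∈ P} := by
    rintro P ⟨hP, h0, hle, hm⟩
    refine ⟨inferInstance, comap_toOverring_ne_bot hAR P h0, ?_, ?_⟩
    · rwa [cardQuot_comap_toOverring hAR P hP h0]
    · rw [Ideal.mem_comap, hr]
      exact P.mul_mem_left _ hm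
  have hinjOn : Set.InjOn (fun P : Ideal R => P.comap (toOverring hAR))
      {P : Ideal R | P.IsPrime ∧ P ≠ ⊥ ∧ Real.exp (β * n) ≤ cardQuot P ∧
      x.1 i j - y.1 i j ∈ P} := by
    rintro P ⟨hP, h0, -, -⟩ P' ⟨hP', h0', -, -⟩ h
    exact comap_toOverring_injective hAR hP h0 hP' h0' h
  refine ⟨Set.Finite.of_injOn hmaps hinjOn hfin, ?_⟩
  have h1 := Set.ncard_le_ncard_of_injOn _ hmaps hinjOn hfin
  have hn1 : (1 : ℝ) ≤ n := by exact_mod_cast hn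
  rw [le_div_iff₀ hβ]
  have hpos : (0 : ℝ) < cardQuot (Ideal.span {a}) := by
    exact_mod_cast Ring.HasFiniteQuotients.cardQuot_pos _ (by simpa using ha0)
  have h2 : Real.log (cardQuot (Ideal.span {a})) ≤
      Real.log F + s.exponent * (Real.log (2 * L₀) + n * Real.log L) := by
    have hle : (cardQuot (Ideal.span {a}) : ℝ) ≤ F * (2 * L₀ * L ^ n) ^ s.exponent :=
      (s.cardQuot_le a ha0).trans (mul_le_mul (le_max_left _ _)
        (pow_le_pow_left₀ (s.nonneg a) hsa _) (pow_nonneg (s.nonneg a) _) (by linarith))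
    refine (Real.log_le_log hpos hle).trans_eq ?_
    rw [Real.log_mul (by positivity) (by positivity), Real.log_pow,
      Real.log_mul (by positivity) (by positivity), Real.log_pow]
  rw [Real.log_exp] at hcount
  have h3 : ({P : Ideal R | P.IsPrime ∧ P ≠ ⊥ ∧ Real.exp (β * n) ≤ cardQuot P ∧
      x.1 i j - y.1 i j ∈ P}.ncard : ℝ) * (β * n) ≤
      Real.log F + s.exponent * (Real.log (2 * L₀) + n * Real.log L) :=
    (mul_le_mul_of_nonneg_right (by exact_mod_cast h1) (by positivity)).trans (hcount.trans h2)
  have hE : (0 : ℝ) ≤ s.exponent := Nat.cast_nonneg _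
  have h4 : Real.log F + s.exponent * (Real.log (2 * L₀) + n * Real.log L) ≤
      (Real.log F + s.exponent * (Real.log (2 * L₀) + Real.log L)) * n := by
    have e1 : Real.log F ≤ Real.log F * n := le_mul_of_one_le_right hlF hn1
    have e2 : s.exponent * Real.log (2 * L₀) ≤ s.exponent * Real.log (2 * L₀) * n :=
      le_mul_of_one_le_right (mul_nonneg hE hlL₀) hn1
    nlinarith
  have h5 := h3.trans h4
  rw [← mul_assoc] at h5
  exact le_of_mul_le_mul_right h5 (by linarith)

/-- Two matrices agree modulo `P` if and only if `P` contains the entries of their difference. -/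
theorem reductionMod_eq_iff {d : ℕ} (P : Ideal R) (x y : Matrix.GeneralLinearGroup (Fin d) R) :
    reductionMod d P x = reductionMod d P y ↔ ∀ i j, x.1 i j - y.1 i j ∈ P := by
  rw [Units.ext_iff, ← Matrix.ext_iff]
  refine forall_congr' fun i => forall_congr' fun j => ?_
  exact Ideal.Quotient.eq

theorem exists_entry_ne {d : ℕ} {x y : Matrix.GeneralLinearGroup (Fin d) R} (h : x ≠ y) :
    ∃ p : Fin d × Fin d, x.1 p.1 p.2 - y.1 p.1 p.2 ≠ 0 := by
  by_contra! hne
  exact h (Units.ext (Matrix.ext fun i j => sub_eq_zero.1 (hne (i, j))))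

/-- The number of primes modulo which `B n` has few residues is at most quadratic in
`exp (α * n)`. -/
theorem exists_ncard_bad_le (s : IdealSize A) (hAR : ∀ a, algebraMap A K a ∈ R) {d : ℕ}
    {W : Set (Matrix.GeneralLinearGroup (Fin d) R)} (hW : W.Finite)
    {B : ℕ → Set (Matrix.GeneralLinearGroup (Fin d) R)} {α : ℝ} (hα : 0 < α)
    (hBW : ∀ n : ℕ, 1 ≤ n → B n ⊆ W ^ n)
    (hBcard : ∀ n : ℕ, 1 ≤ n → Real.exp (α * n) ≤ ((B n).ncard : ℝ)) :
    ∃ κ : ℝ, ∀ n : ℕ, 1 ≤ n →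
      ({P ∈ primesInInterval R (Real.exp (3 * α * n)) (Real.exp (4 * α * n)) |
        ¬ (primeNorm P : ℝ) ^ (1 / 4 : ℝ) ≤ ((reductionMod d P '' B n).ncard : ℝ)}.ncard : ℝ) ≤
        κ * Real.exp (2 * α * n) := by
  classical
  obtain ⟨κ, hκ⟩ := exists_ncard_primes_le s hAR hW (show 0 < 3 * α by positivity)
  refine ⟨4 * max κ 0, fun n hn => ?_⟩
  have hBfin : (B n).Finite := (finite_set_pow hW n).subset (hBW n hn)
  -- B n may be much larger; N of its elements suffice for pigeonhole and keep the number of pairs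
  -- O(e^(2αn)).
  set N := ⌈Real.exp (α * n)⌉₊ with hN
  obtain ⟨F, hFB, hFN⟩ := Set.exists_subset_card_eq (s := B n) (n := N)
    (by exact Nat.ceil_le.2 (hBcard n hn))
  have hFfin : F.Finite := hBfin.subset hFB
  set G := hFfin.toFinset with hG
  have hGN : G.card = N := by rw [hG, ← Set.ncard_eq_toFinset_card F hFfin, hFN]
  have hGmem : ∀ x ∈ G, x ∈ B n := fun x hx => hFB (hFfin.mem_toFinset.1 hx)
  let e : Matrix.GeneralLinearGroup (Fin d) R × Matrix.GeneralLinearGroup (Fin d) R →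
      Set (Ideal R) := fun q => {P | ∃ h : q.1 ≠ q.2, P.IsPrime ∧ P ≠ ⊥ ∧
        Real.exp (3 * α * n) ≤ cardQuot P ∧
        q.1.1 (exists_entry_ne h).choose.1 (exists_entry_ne h).choose.2 -
          q.2.1 (exists_entry_ne h).choose.1 (exists_entry_ne h).choose.2 ∈ P}
  have he : ∀ q ∈ G.offDiag, (e q).Finite ∧ ((e q).ncard : ℝ) ≤ max κ 0 := by
    rintro ⟨x, y⟩ hq
    obtain ⟨hx, hy, hne⟩ := Finset.mem_offDiag.1 hq
    have h1 := hκ n hn x (hBW n hn (hGmem x hx)) y (hBW n hn (hGmem y hy))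
      (exists_entry_ne hne).choose.1 (exists_entry_ne hne).choose.2
      (exists_entry_ne hne).choose_spec
    have h2 : e (x, y) = {P : Ideal R | P.IsPrime ∧ P ≠ ⊥ ∧ Real.exp (3 * α * n) ≤ cardQuot P ∧
        x.1 (exists_entry_ne hne).choose.1 (exists_entry_ne hne).choose.2 -
          y.1 (exists_entry_ne hne).choose.1 (exists_entry_ne hne).choose.2 ∈ P} := by
      ext P
      exact ⟨fun ⟨_, h⟩ => h, fun h => ⟨hne, h⟩⟩
    rw [h2]
    exact ⟨h1.1, h1.2.trans (le_max_left _ _)⟩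
  have hsub : {P ∈ primesInInterval R (Real.exp (3 * α * n)) (Real.exp (4 * α * n)) |
      ¬ (primeNorm P : ℝ) ^ (1 / 4 : ℝ) ≤ ((reductionMod d P '' B n).ncard : ℝ)} ⊆
      ⋃ q ∈ G.offDiag, e q := by
    rintro P ⟨⟨hP, h0, hlo, hhi⟩, hbad⟩
    have hroot : (primeNorm P : ℝ) ^ (1 / 4 : ℝ) ≤ N := by
      calc (primeNorm P : ℝ) ^ (1 / 4 : ℝ) ≤ Real.exp (4 * α * n) ^ (1 / 4 : ℝ) :=
            Real.rpow_le_rpow (Nat.cast_nonneg _) hhi (by norm_num)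
        _ = Real.exp (α * n) := by rw [← Real.exp_mul]; congr 1; ring
        _ ≤ N := Nat.le_ceil _
    have hlt : ((reductionMod d P '' B n).ncard : ℝ) < N := (not_le.1 hbad).trans_le hroot
    have hmaps : (G.image (reductionMod d P)).card < G.card := by
      rw [hGN]
      refine lt_of_le_of_lt ?_ (show (reductionMod d P '' B n).ncard < N by exact_mod_cast hlt)
      rw [← Set.ncard_coe_finset]
      refine Set.ncard_le_ncard ?_ (hBfin.image _)
      intro z hz
      obtain ⟨x, hx, rfl⟩ := Finset.mem_image.1 hz
      exact ⟨x, hGmem x hx, rfl⟩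
    obtain ⟨x, hx, y, hy, hne, hxy⟩ := Finset.exists_ne_map_eq_of_card_image_lt hmaps
    refine Set.mem_biUnion (show (x, y) ∈ G.offDiag from Finset.mem_offDiag.2 ⟨hx, hy, hne⟩) ?_
    exact ⟨hne, hP, h0, hlo, (reductionMod_eq_iff P x y).1 hxy _ _⟩
  have hunion : (⋃ q ∈ G.offDiag, e q).Finite :=
    G.offDiag.finite_toSet.biUnion fun q hq => (he q hq).1
  have h1 : ((⋃ q ∈ G.offDiag, e q).ncard : ℝ) ≤ ∑ q ∈ G.offDiag, ((e q).ncard : ℝ) := by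
    exact_mod_cast Finset.set_ncard_biUnion_le _ _
  have h2 : ∑ q ∈ G.offDiag, ((e q).ncard : ℝ) ≤ G.offDiag.card * max κ 0 := by
    rw [← nsmul_eq_mul]
    exact Finset.sum_le_card_nsmul _ _ _ fun q hq => (he q hq).2
  have h3 : (G.offDiag.card : ℝ) ≤ N * N := by
    rw [Finset.offDiag_card, hGN]
    exact_mod_cast Nat.sub_le _ _
  have h4 : (N : ℝ) ≤ 2 * Real.exp (α * n) := by
    have := Nat.ceil_lt_add_one (Real.exp_pos (α * n)).le
    have h5 : 1 ≤ Real.exp (α * n) := Real.one_le_exp (by positivity)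
    linarith
  have h5 : Real.exp (2 * α * n) = Real.exp (α * n) * Real.exp (α * n) := by
    rw [← Real.exp_add]; congr 1; ring
  have h6 : (N : ℝ) * N ≤ 4 * Real.exp (2 * α * n) := by
    rw [h5]
    have : (0 : ℝ) ≤ N := Nat.cast_nonneg _
    nlinarith
  calc _ ≤ ((⋃ q ∈ G.offDiag, e q).ncard : ℝ) := by exact_mod_cast Set.ncard_le_ncard hsub hunion
    _ ≤ G.offDiag.card * max κ 0 := h1.trans h2
    _ ≤ (4 * Real.exp (2 * α * n)) * max κ 0 :=
        mul_le_mul_of_nonneg_right (h3.trans h6) (le_max_right _ _)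
    _ = _ := by ring

/-- Most reductions are large, for overrings of a Dedekind domain with enough primes and a size function. -/
theorem reduction_large_of_overring (hA : EquidistributedIdeals A) (s : IdealSize A)
    (hAR : ∀ a, algebraMap A K a ∈ R) (hT : (nonintegralPrimes A R).Finite)
    (d : ℕ) (W : Set (Matrix.GeneralLinearGroup (Fin d) R)) (hW : W.Finite)
    (B : ℕ → Set (Matrix.GeneralLinearGroup (Fin d) R)) (α : ℝ) (hα : 0 < α)
    (hBW : ∀ n : ℕ, 1 ≤ n → B n ⊆ W ^ n)
    (hBcard : ∀ n : ℕ, 1 ≤ n → Real.exp (α * n) ≤ ((B n).ncard : ℝ)) :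
    (∀ n : ℕ, (primesInInterval R (Real.exp (3 * α * n)) (Real.exp (4 * α * n))).Finite) ∧
    (∀ᶠ n : ℕ in atTop,
      (primesInInterval R (Real.exp (3 * α * n)) (Real.exp (4 * α * n))).Nonempty) ∧
    Tendsto (fun n : ℕ =>
      (({P ∈ primesInInterval R (Real.exp (3 * α * n)) (Real.exp (4 * α * n)) |
          (primeNorm P : ℝ) ^ (1 / 4 : ℝ) ≤ ((reductionMod d P '' B n).ncard : ℝ)}.ncard : ℕ) : ℝ) /
        ((primesInInterval R (Real.exp (3 * α * n)) (Real.exp (4 * α * n))).ncard : ℝ))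
      atTop (𝓝 1) := by
  have hfin := fun n : ℕ => primesInInterval_overring_finite hAR
    (Real.exp (3 * α * n)) (Real.exp (4 * α * n))
  obtain ⟨c, hc, hcount⟩ := exists_le_ncard_primesInInterval hA
  obtain ⟨κ, hκ⟩ := exists_ncard_bad_le s hAR hW hα hBW hBcard
  have hexp : ∀ β : ℝ, 0 < β → Tendsto (fun n : ℕ => Real.exp (β * n)) atTop atTop := fun β hβ =>
    Real.tendsto_exp_atTop.comp (tendsto_natCast_atTop_atTop.const_mul_atTop hβ)
  -- Half of the constant absorbs the finitely many primes of A that do not lift to R.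
  have hlow : ∀ᶠ n : ℕ in atTop, c / 2 * Real.exp (3 * α * n) ≤
      ((primesInInterval R (Real.exp (3 * α * n)) (Real.exp (4 * α * n))).ncard : ℝ) := by
    filter_upwards [(hexp (4 * α) (by positivity)).eventually hcount,
      (hexp (3 * α) (by positivity)).eventually_ge_atTop
        ((nonintegralPrimes A R).ncard / (c / 2))] with n h1 h2
    have e : Real.exp (4 * α * n) ^ (3 / 4 : ℝ) = Real.exp (3 * α * n) := by
      rw [← Real.exp_mul]; congr 1; ring
    rw [e] at h1
    rw [div_le_iff₀ (by positivity)] at h2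
    have h3 : ((primesInInterval A (Real.exp (3 * α * n)) (Real.exp (4 * α * n))).ncard : ℝ) ≤
        (primesInInterval R (Real.exp (3 * α * n)) (Real.exp (4 * α * n))).ncard +
          (nonintegralPrimes A R).ncard := by
      exact_mod_cast ncard_primesInInterval_le_overring hAR hT _ _
    linarith
  have hpos : ∀ᶠ n : ℕ in atTop,
      (0 : ℝ) < (primesInInterval R (Real.exp (3 * α * n)) (Real.exp (4 * α * n))).ncard :=
    hlow.mono fun n h => lt_of_lt_of_le (by positivity) h
  refine ⟨hfin, hpos.mono fun n h => ?_, ?_⟩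
  · refine Set.nonempty_of_ncard_ne_zero fun h0 => ?_
    rw [h0, Nat.cast_zero] at h
    exact lt_irrefl _ h
  have hlim : Tendsto (fun n : ℕ => 1 - 2 * κ / c * Real.exp (-(α * n))) atTop (𝓝 1) := by
    have := ((Real.tendsto_exp_neg_atTop_nhds_zero.comp
      (tendsto_natCast_atTop_atTop.const_mul_atTop hα)).const_mul (2 * κ / c)).const_sub 1
    simpa using this
  refine tendsto_of_tendsto_of_tendsto_of_le_of_le' hlim tendsto_const_nhds ?_ ?_
  · filter_upwards [hlow, hpos, eventually_ge_atTop 1] with n h1 h2 hn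
    have hbad := hκ n hn
    set P := primesInInterval R (Real.exp (3 * α * n)) (Real.exp (4 * α * n)) with hP
    have hsplit : {p ∈ P | (primeNorm p : ℝ) ^ (1 / 4 : ℝ) ≤
        ((reductionMod d p '' B n).ncard : ℝ)}.ncard + {p ∈ P | ¬ (primeNorm p : ℝ) ^ (1 / 4 : ℝ) ≤
        ((reductionMod d p '' B n).ncard : ℝ)}.ncard = P.ncard := by
      rw [← Set.ncard_union_eq _ ((hfin n).subset fun _ h => h.1) ((hfin n).subset fun _ h => h.1)]
      · congr 1
        ext p
        simp only [Set.mem_union, Set.mem_ofPred_eq]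
        tauto
      · exact Set.disjoint_left.2 fun p h h' => h'.2 h.2
    have hsplit' : ({p ∈ P | (primeNorm p : ℝ) ^ (1 / 4 : ℝ) ≤
        ((reductionMod d p '' B n).ncard : ℝ)}.ncard : ℝ) + ({p ∈ P |
        ¬ (primeNorm p : ℝ) ^ (1 / 4 : ℝ) ≤
        ((reductionMod d p '' B n).ncard : ℝ)}.ncard : ℝ) = P.ncard := by exact_mod_cast hsplit
    rw [le_div_iff₀ h2]
    have e : Real.exp (2 * α * n) = Real.exp (-(α * n)) * Real.exp (3 * α * n) := by
      rw [← Real.exp_add]; congr 1; ring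
    have hκ0 : 0 ≤ κ := by
      have := (Nat.cast_nonneg _).trans hbad
      exact nonneg_of_mul_nonneg_left this (Real.exp_pos _)
    have h3 : κ * Real.exp (2 * α * n) ≤ 2 * κ / c * Real.exp (-(α * n)) * P.ncard := by
      rw [e]
      calc κ * (Real.exp (-(α * n)) * Real.exp (3 * α * n))
          = 2 * κ / c * Real.exp (-(α * n)) * (c / 2 * Real.exp (3 * α * n)) := by field_simp
        _ ≤ _ := mul_le_mul_of_nonneg_left h1 (by positivity)
    linarith
  · filter_upwards [hpos] with n h2
    rw [div_le_one h2]
    exact_mod_cast Set.ncard_le_ncard (Set.sep_subset _ _) (hfin n)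

end Counting

/-! ### Places and integrality of S-integers -/

section Places

variable {K : Type*} [Field K]

/-- The valuation subring of a non-Archimedean absolute value. -/
def AbsoluteValue.valuationSubring (w : AbsoluteValue K ℝ) (hw : IsNonarchimedean w) :
    ValuationSubring K where
  carrier := {a | w a ≤ 1}
  mul_mem' {a b} ha hb := by
    change w (a * b) ≤ 1
    rw [map_mul]
    exact mul_le_one₀ ha (w.nonneg b) hb
  one_mem' := (map_one w).le
  add_mem' {a b} ha hb := (hw a b).trans (max_le ha hb)
  zero_mem' := (map_zero w).le.trans zero_le_one
  neg_mem' {a} ha := by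
    change w (-a) ≤ 1
    rwa [AbsoluteValue.map_neg]
  mem_or_inv_mem' a := by
    change w a ≤ 1 ∨ w a⁻¹ ≤ 1
    rw [map_inv₀]
    rcases le_total (w a) 1 with h | h
    · exact Or.inl h
    · exact Or.inr (inv_le_one_of_one_le₀ h)

theorem AbsoluteValue.le_one_of_isIntegral {O : Type*} [CommRing O] [Algebra O K]
    (w : AbsoluteValue K ℝ) (hw : IsNonarchimedean w) (hO : ∀ o, w (algebraMap O K o) ≤ 1) {x : K}
    (hx : IsIntegral O x) : w x ≤ 1 := by
  let V := w.valuationSubring hw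
  let f : O →+* V := (algebraMap O K).codRestrict V hO
  have h : IsIntegral V (RingHom.id K x) :=
    hx.map_of_comp_eq f (RingHom.id K) (by ext; rfl)
  obtain ⟨y, hy⟩ := IsIntegrallyClosed.algebraMap_eq_of_integral h
  have hy' : (y : K) = x := hy
  rw [← hy']
  exact y.2

variable {S : Set (Place K)} {hS : ∀ v : Place K, v.IsArchimedean → v ∈ S}

/-- Places outside S are non-Archimedean, so the S-integers are an intersection of valuation rings
and hence integrally closed. -/
theorem SIntegers.mem_of_isIntegral {O : Type*} [CommRing O] [Algebra O K]
    (hO : ∀ o, algebraMap O K o ∈ SIntegers S hS) {x : K} (hx : IsIntegral O x) :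
    x ∈ SIntegers S hS := by
  intro v hv
  have hna : ¬ v.IsArchimedean := fun h => hv (hS v h)
  have hO' : ∀ o, v.LeOne (algebraMap O K o) := fun o => hO o v hv
  clear hv hO
  induction v using Quotient.inductionOn with
  | h w =>
    change ¬ ¬ IsNonarchimedean w.1 at hna
    exact w.1.le_one_of_isIntegral (not_not.1 hna) hO' hx

section Dedekind

open IsDedekindDomain

variable {A : Type*} [CommRing A] [IsDedekindDomain A] [Algebra A K] [IsFractionRing A K]

theorem IsDedekindDomain.HeightOneSpectrum.isNontrivial_adicAbv (v : HeightOneSpectrum A) :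
    (v.adicAbv (K := K) one_lt_two).IsNontrivial := by
  obtain ⟨a, ha, ha0⟩ := Submodule.exists_mem_ne_zero_of_ne_bot v.ne_bot
  refine ⟨algebraMap A K a, ?_, ?_⟩
  · rwa [Ne, FaithfulSMul.algebraMap_eq_zero_iff]
  · exact ((v.adicAbv_coe_lt_one_iff one_lt_two a).2 ha).ne

variable (K) in
/-- The place of the fraction field defined by a maximal ideal of a Dedekind domain. -/
noncomputable def IsDedekindDomain.HeightOneSpectrum.place (v : HeightOneSpectrum A) : Place K :=
  Quotient.mk (Place.setoid K) ⟨v.adicAbv one_lt_two, v.isNontrivial_adicAbv⟩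

/-- The ideal is recovered from the place as the elements of A of absolute value < 1. -/
theorem IsDedekindDomain.HeightOneSpectrum.place_injective :
    Function.Injective (HeightOneSpectrum.place (A := A) K) := by
  intro v w h
  have he : (v.adicAbv (K := K) one_lt_two).IsEquiv (w.adicAbv one_lt_two) := Quotient.exact h
  refine HeightOneSpectrum.ext (Ideal.ext fun a => ?_)
  rw [← v.adicAbv_coe_lt_one_iff (K := K) one_lt_two, he.lt_one_iff,
    w.adicAbv_coe_lt_one_iff]

theorem IsDedekindDomain.HeightOneSpectrum.leOne_place_iff (v : HeightOneSpectrum A) (x : K) :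
    (v.place K).LeOne x ↔ v.valuation K x ≤ 1 := by
  change v.adicAbv one_lt_two x ≤ 1 ↔ _
  simp [adicAbv, adicAbvDef, WithZeroMulInt.toNNReal_le_one_iff one_lt_two]

/-- If the place of p is outside S, every S-integer is p-integral; hence the exceptional primes
inject into S. -/
theorem finite_nonintegralPrimes_SIntegers (hSfin : S.Finite) :
    (nonintegralPrimes A (SIntegers S hS)).Finite := by
  have hfin : (HeightOneSpectrum.place (A := A) K ⁻¹' S).Finite :=
    hSfin.preimage HeightOneSpectrum.place_injective.injOn
  refine (hfin.image HeightOneSpectrum.asIdeal).subset ?_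
  rintro p ⟨hp, h0, hne⟩
  refine ⟨⟨p, hp, h0⟩, ?_, rfl⟩
  by_contra hv
  refine hne fun x hx => ?_
  obtain ⟨n, d, h⟩ := HeightOneSpectrum.exists_primeCompl_mul_eq_of_integer (K := K) ⟨p, hp, h0⟩ x
    ((HeightOneSpectrum.leOne_place_iff _ x).1 (hx _ hv))
  exact ⟨n, d, d.2, h⟩

end Dedekind

end Places

/-! ### The number field case -/

section NumberField

theorem NumberField.reduction_large {K : Type*} [Field K] [NumberField K]
    (S : Set (Place K)) (hSfin : S.Finite)
    (hSarch : ∀ v : Place K, v.IsArchimedean → v ∈ S)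
    (d : ℕ) (W : Set (Matrix.GeneralLinearGroup (Fin d) (SIntegers S hSarch))) (hW : W.Finite)
    (B : ℕ → Set (Matrix.GeneralLinearGroup (Fin d) (SIntegers S hSarch)))
    (α : ℝ) (hα : 0 < α)
    (hBW : ∀ n : ℕ, 1 ≤ n → B n ⊆ W ^ n)
    (hBcard : ∀ n : ℕ, 1 ≤ n → Real.exp (α * n) ≤ ((B n).ncard : ℝ)) :
    (∀ n : ℕ, (primesInInterval (SIntegers S hSarch)
        (Real.exp (3 * α * n)) (Real.exp (4 * α * n))).Finite) ∧
    (∀ᶠ n : ℕ in atTop, (primesInInterval (SIntegers S hSarch)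
        (Real.exp (3 * α * n)) (Real.exp (4 * α * n))).Nonempty) ∧
    Tendsto (fun n : ℕ =>
      (({P ∈ primesInInterval (SIntegers S hSarch)
            (Real.exp (3 * α * n)) (Real.exp (4 * α * n)) |
          (primeNorm P : ℝ) ^ (1 / 4 : ℝ) ≤ ((reductionMod d P '' B n).ncard : ℝ)}.ncard : ℕ) : ℝ) /
        ((primesInInterval (SIntegers S hSarch)
            (Real.exp (3 * α * n)) (Real.exp (4 * α * n))).ncard : ℝ))
      atTop (𝓝 1) := by
  classical
  have hinf : Infinite (NumberField.RingOfIntegers K) := inferInstance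
  have s : IdealSize (NumberField.RingOfIntegers K) :=
    IdealSize.ofBasis AbsoluteValue.abs (NumberField.RingOfIntegers.basis K) fun a _ => by
      have h := Ideal.absNorm_span_singleton a
      change ((Ideal.absNorm (Ideal.span {a}) : ℕ) : ℤ) ≤ _
      rw [h, Int.natCast_natAbs]
      rfl
  refine reduction_large_of_overring (NumberField.equidistributedIdeals K) s (fun a => ?_)
    (finite_nonintegralPrimes_SIntegers hSfin) d W hW B α hα hBW hBcard
  refine SIntegers.mem_of_isIntegral (O := ℤ) (fun o => ?_) (NumberField.RingOfIntegers.isIntegral_coe a)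
  rw [eq_intCast]
  exact intCast_mem _ o

end NumberField

/-! ### Separating elements in transcendence degree one -/

section SeparatingElement

open IntermediateField Polynomial

variable {k K : Type*} [Field k] [Field K] [Algebra k K]

theorem Transcendental.isTranscendenceBasis_singleton (htr : Algebra.trdeg k K = 1) {x : K}
    (hx : Transcendental k x) : IsTranscendenceBasis k ((↑) : ({x} : Set K) → K) := by
  refine AlgebraicIndependent.isTranscendenceBasis_of_trdeg_le_of_finite
    ((algebraicIndependent_singleton_iff (⟨x, rfl⟩ : ({x} : Set K))).2 hx) ?_
  rw [htr, Cardinal.mk_fintype]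
  simp

theorem Transcendental.isAlgebraic_adjoin (htr : Algebra.trdeg k K = 1) {x : K}
    (hx : Transcendental k x) : Algebra.IsAlgebraic (Algebra.adjoin k {x}) K := by
  have h := (hx.isTranscendenceBasis_singleton htr).isAlgebraic
  rwa [Subtype.range_coe] at h

theorem Transcendental.finiteDimensional_adjoin (hfg : (⊤ : IntermediateField k K).FG)
    (htr : Algebra.trdeg k K = 1) {x : K} (hx : Transcendental k x) :
    FiniteDimensional k⟮x⟯ K := by
  have := IntermediateField.fg_top_iff.1 hfg
  have : Algebra.EssFiniteType k⟮x⟯ K := .of_comp k _ _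
  have : Algebra.IsAlgebraic k⟮x⟯ K := isAlgebraic_adjoin_iff_top.2 (hx.isAlgebraic_adjoin htr)
  exact Algebra.finite_of_essFiniteType_of_isAlgebraic

/-- Frobenius on K is injective and semilinear over the bijective Frobenius of k. -/
theorem linearIndepOn_pow_of_perfectField [PerfectField k] (p : ℕ) [hp : Fact p.Prime] [CharP k p]
    (t : Finset K) (ht : LinearIndepOn k _root_.id (t : Set K)) :
    LinearIndepOn k (· ^ p) (t : Set K) := by
  have : ExpChar k p := .prime hp.out
  have : CharP K p := .of_ringHom_of_ne_zero (algebraMap k K) p hp.out.ne_zero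
  have : ExpChar K p := .prime hp.out
  apply ht.map_of_injective_injective (frobeniusEquiv k p).symm (frobenius K p).toAddMonoidHom
  case hc =>
    intro r m
    change ((frobeniusEquiv k p).symm r • m) ^ p = r • m ^ p
    rw [Algebra.smul_def, mul_pow, ← map_pow, frobeniusEquiv_symm_pow_p, Algebra.smul_def]
  all_goals simp [frobenius]

/-- The separable closure of k(z) in K lies in that of k(y), and y itself makes the inclusion
strict. This is the descent step for inseparable degrees. -/
theorem finrank_separableClosure_adjoin_lt {y z : K} [FiniteDimensional k⟮z⟯ K]
    (hz : IsSeparable k⟮y⟯ z) (hy : ¬ IsSeparable k⟮z⟯ y) :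
    Module.finrank ((separableClosure k⟮y⟯ K).restrictScalars k) K <
      Module.finrank ((separableClosure k⟮z⟯ K).restrictScalars k) K := by
  have : Module.Finite ((separableClosure k⟮z⟯ K).restrictScalars k) K :=
    inferInstanceAs <| Module.Finite (separableClosure k⟮z⟯ K) K
  have hlt : (separableClosure k⟮z⟯ K).restrictScalars k <
      (separableClosure k⟮y⟯ K).restrictScalars k := by
    refine SetLike.lt_iff_le_and_exists.mpr ⟨?_, y, ?_, hy⟩
    · rw [separableClosure_le_separableClosure_iff, adjoin_le_iff]
      rintro x rfl
      exact hz
    · exact le_restrictScalars_separableClosure _ (mem_adjoin_simple_self k y)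
  exact finrank_lt_of_gt hlt

/-- A set containing a transcendental element contains a separating element for all of its
members. -/
theorem exists_transcendental_forall_isSeparable [PerfectField k] {p : ℕ} [hp : Fact p.Prime]
    [CharP k p] (hfg : (⊤ : IntermediateField k K).FG) (htr : Algebra.trdeg k K = 1) {s : Set K}
    (hs : ∃ x ∈ s, Transcendental k x) :
    ∃ z ∈ s, Transcendental k z ∧ ∀ x ∈ s, IsSeparable k⟮z⟯ x := by
  have : ExpChar k p := .prime hp.out
  -- d is the degree of K over the separable closure of k(z), the inseparable degree; z is chosen to
  -- minimise it.
  let d (z : K) : ℕ := Module.finrank ((separableClosure k⟮z⟯ K).restrictScalars k) K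
  let Z : Set K := {z | z ∈ s ∧ Transcendental k z}
  have hZ : Z.Nonempty := hs
  obtain ⟨hzs, hzt⟩ : Function.argminOn d Z hZ ∈ Z := Function.argminOn_mem d Z hZ
  have hmin : ∀ n ∈ Z, ¬ d n < d (Function.argminOn d Z hZ) := fun n hn =>
    Function.not_lt_argminOn d Z hn
  generalize Function.argminOn d Z hZ = z at hzs hzt hmin
  refine ⟨z, hzs, hzt, fun n hns => of_not_not fun hn => ?_⟩
  have hb := hzt.isTranscendenceBasis_singleton htr
  have hnz : n ≠ z := by
    rintro rfl
    exact hn (le_restrictScalars_separableClosure _ (mem_adjoin_simple_self k n))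
  have H := linearIndepOn_pow_of_perfectField (k := k) (K := K) p
  -- MacLane's argument singles out i separable over the rest of {n, z}. If i = n there is nothing
  -- to prove, i = z contradicts minimality, and any other i would make {n, z} a transcendence basis
  -- with two elements.
  obtain ⟨i, hi₁, hi₂⟩ := exists_isTranscendenceBasis_and_isSeparable_of_linearIndepOn_pow'
    p hp.out (a := id) H {z} n hb hnz
  rw [Set.image_id] at hi₂
  by_cases hin : i = n
  · subst hin
    rw [Set.insert_sdiff_of_mem _ (Set.mem_singleton i),
      Set.sdiff_singleton_eq_self (by simpa using hnz)] at hi₂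
    exact hn hi₂
  by_cases hiz : i = z
  · subst hiz
    have e : insert n {i} \ {i} = ({n} : Set K) := by
      rw [Set.pair_comm, Set.insert_sdiff_of_mem _ (Set.mem_singleton i),
        Set.sdiff_singleton_eq_self (by simpa using hnz.symm)]
    rw [e] at hi₁ hi₂
    have hnt : Transcendental k n :=
      (algebraicIndependent_singleton_iff (⟨n, rfl⟩ : ({n} : Set K))).1 hi₁.1
    have := hzt.finiteDimensional_adjoin hfg htr
    exact hmin n ⟨hns, hnt⟩ (finrank_separableClosure_adjoin_lt hi₂ hn)
  · rw [Set.sdiff_singleton_eq_self (by simp [hin, hiz])] at hi₁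
    have h := hi₁.cardinalMk_eq hb
    rw [Cardinal.mk_insert (by simpa using hnz), Cardinal.mk_singleton] at h
    norm_num at h

end SeparatingElement

/-! ### The integral closure of a polynomial ring -/

section FunctionFieldRing

open Polynomial IntermediateField

variable {k K : Type*} [Field k] [Field K] [Algebra k K] [Algebra k[X] K] [IsScalarTower k k[X] K]

theorem algebraMap_polynomial_eq_aeval (p : k[X]) :
    algebraMap k[X] K p = aeval (algebraMap k[X] K X) p := by
  rw [aeval_algebraMap_apply, aeval_X_left_apply]

theorem algebraMap_mem_adjoin (p : k[X]) : algebraMap k[X] K p ∈ k⟮algebraMap k[X] K X⟯ := by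
  refine (mem_adjoin_simple_iff k _).2 ⟨p, 1, ?_⟩
  rw [map_one, div_one]
  exact algebraMap_polynomial_eq_aeval p

variable (k K) in
-- Transcendence identifies the fraction field of k[X] with a subfield over which K is finite
-- separable. Separability makes the integral closure finite, and k[X] being principal makes it
-- free.
theorem integralClosure_polynomial_properties
    (hX : Transcendental k (algebraMap k[X] K X))
    [FiniteDimensional k⟮algebraMap k[X] K X⟯ K]
    [Algebra.IsSeparable k⟮algebraMap k[X] K X⟯ K] :
    IsDedekindDomain (integralClosure k[X] K) ∧ IsFractionRing (integralClosure k[X] K) K ∧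
      Module.Finite k[X] (integralClosure k[X] K) ∧ Module.Free k[X] (integralClosure k[X] K) := by
  have hinj : Function.Injective (algebraMap k[X] K) := by
    intro p q h
    rw [algebraMap_polynomial_eq_aeval p, algebraMap_polynomial_eq_aeval q] at h
    exact transcendental_iff_injective.1 hX h
  let f : k[X] →+* k⟮algebraMap k[X] K X⟯ :=
    (algebraMap k[X] K).codRestrict _ algebraMap_mem_adjoin
  let := f.toAlgebra
  have : IsScalarTower k[X] k⟮algebraMap k[X] K X⟯ K := .of_algebraMap_eq fun _ => rfl
  have : FaithfulSMul k[X] k⟮algebraMap k[X] K X⟯ := by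
    rw [faithfulSMul_iff_algebraMap_injective]
    exact fun p q h => hinj (congrArg Subtype.val h)
  have : FaithfulSMul k[X] K := (faithfulSMul_iff_algebraMap_injective _ _).2 hinj
  have : IsFractionRing k[X] k⟮algebraMap k[X] K X⟯ := by
    refine IsFractionRing.of_field _ _ fun x => ?_
    obtain ⟨r, s, h⟩ := (mem_adjoin_simple_iff k (x : K)).1 x.2
    refine ⟨r, s, Subtype.ext ?_⟩
    rw [h, ← algebraMap_polynomial_eq_aeval, ← algebraMap_polynomial_eq_aeval]
    rfl
  exact ⟨IsIntegralClosure.isDedekindDomain k[X] k⟮algebraMap k[X] K X⟯ K _,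
    integralClosure.isFractionRing_of_finite_extension k⟮algebraMap k[X] K X⟯ K,
    IsIntegralClosure.finite k[X] k⟮algebraMap k[X] K X⟯ K _,
    IsIntegralClosure.module_free k[X] k⟮algebraMap k[X] K X⟯ K _⟩

end FunctionFieldRing

/-! ### Growth and transcendental elements -/

section Transcendental

variable {k K : Type*} [Field k] [Finite k] [Field K] [Algebra k K] {R : Subring K}

theorem algebraMap_mem_of_finite (hR : ∀ x : K, IsIntegral R x → x ∈ R) (c : k) :
    algebraMap k K c ∈ R := by
  have h : IsIntegral ℤ (algebraMap k K c) :=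
    (Algebra.IsIntegral.isIntegral (R := ℤ) c).map (Algebra.ofId k K |>.restrictScalars ℤ)
  exact hR _ h.tower_top

/-- The elements of `GL_d(R)` whose entries lie in a subalgebra of `K`. -/
def entriesSubmonoid (R : Subring K) (T : Subalgebra k K) (d : ℕ) :
    Submonoid (Matrix.GeneralLinearGroup (Fin d) R) where
  carrier := {g | ∀ i j, (g.1 i j : K) ∈ T}
  one_mem' i j := by
    rw [Units.val_one, Matrix.one_apply]
    split_ifs
    · exact T.one_mem
    · exact T.zero_mem
  mul_mem' {g h} hg hh i j := by
    rw [Units.val_mul, Matrix.mul_apply, AddSubmonoidClass.coe_finsetSum]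
    exact T.sum_mem fun l _ => T.mul_mem (hg i l) (hh l j)

theorem finite_entriesSubmonoid (T : Subalgebra k K) [Finite T] (d : ℕ) :
    (entriesSubmonoid R T d : Set (Matrix.GeneralLinearGroup (Fin d) R)).Finite := by
  refine Set.finite_coe_iff.1 ?_
  refine Finite.of_injective (fun g : entriesSubmonoid R T d =>
    fun i j => (⟨g.1.1 i j, g.2 i j⟩ : T)) fun g h hgh => ?_
  refine Subtype.ext (Units.ext (Matrix.ext fun i j => Subtype.ext ?_))
  exact congrArg (fun t : T => (t : K)) (congrFun (congrFun hgh i) j)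

/-- Exponential growth forces transcendental elements. -/
theorem exists_transcendental_of_growth {d : ℕ}
    {W : Set (Matrix.GeneralLinearGroup (Fin d) R)} (hW : W.Finite)
    {B : ℕ → Set (Matrix.GeneralLinearGroup (Fin d) R)} {α : ℝ} (hα : 0 < α)
    (hBW : ∀ n : ℕ, 1 ≤ n → B n ⊆ W ^ n)
    (hBcard : ∀ n : ℕ, 1 ≤ n → Real.exp (α * n) ≤ ((B n).ncard : ℝ)) :
    ∃ x ∈ R, Transcendental k x := by
  by_contra! hne
  have halg : ∀ x ∈ R, IsIntegral k x := fun x hx =>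
    isAlgebraic_iff_isIntegral.1 (not_not.1 (hne x hx))
  -- If R were algebraic over k, the entries of W would generate a finite algebra, confining all W^n
  -- to one finite set.
  let E : Set K := ⋃ i, ⋃ j, (fun g : Matrix.GeneralLinearGroup (Fin d) R => (g.1 i j : K)) '' W
  have hE : E.Finite := Set.finite_iUnion fun i => Set.finite_iUnion fun j => hW.image _
  have hEint : ∀ x ∈ E, IsIntegral k x := by
    intro x hx
    obtain ⟨i, hx⟩ := Set.mem_iUnion.1 hx
    obtain ⟨j, g, -, rfl⟩ := Set.mem_iUnion.1 hx
    exact halg _ (g.1 i j).2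
  have hfin : Module.Finite k (Algebra.adjoin k E) :=
    Module.Finite.iff_fg.2 (fg_adjoin_of_finite hE hEint)
  have : Finite (Algebra.adjoin k E) := Module.finite_of_finite k
  have hG := finite_entriesSubmonoid (R := R) (Algebra.adjoin k E) d
  have hWG : W ⊆ entriesSubmonoid R (Algebra.adjoin k E) d := fun g hg i j =>
    Algebra.subset_adjoin (Set.mem_iUnion.2 ⟨i, Set.mem_iUnion.2 ⟨j, g, hg, rfl⟩⟩)
  have hpow : ∀ n : ℕ, W ^ n ⊆ entriesSubmonoid R (Algebra.adjoin k E) d := by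
    intro n
    induction n with
    | zero => rw [pow_zero]; rintro _ rfl; exact Submonoid.one_mem _
    | succ n ih =>
      rw [pow_succ]
      rintro _ ⟨a, ha, b, hb, rfl⟩
      exact Submonoid.mul_mem _ (ih ha) (hWG hb)
  have hlim : Tendsto (fun n : ℕ => Real.exp (α * n)) atTop atTop :=
    Real.tendsto_exp_atTop.comp (tendsto_natCast_atTop_atTop.const_mul_atTop hα)
  obtain ⟨n, hn, hn1⟩ := ((hlim.eventually_gt_atTop
    ((entriesSubmonoid R (Algebra.adjoin k E) d :
      Set (Matrix.GeneralLinearGroup (Fin d) R)).ncard : ℝ)).and (eventually_ge_atTop 1)).exists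
  refine absurd (hn.trans_le (hBcard n hn1)) (not_lt.2 ?_)
  exact_mod_cast Set.ncard_le_ncard ((hBW n hn1).trans (hpow n)) hG

end Transcendental

/-! ### The function field case -/

section FunctionField

open IntermediateField Polynomial

variable {k K : Type*} [Field k] [Finite k] [Field K] [Algebra k K] {R : Subring K}

/-- K is algebraic over k[y] ⊆ R, so x becomes integral after clearing a denominator. Thus K is the
fraction field of R. -/
theorem exists_mul_mem_of_transcendental (htr : Algebra.trdeg k K = 1)
    (hR : ∀ x : K, IsIntegral R x → x ∈ R) {y : K} (hyR : y ∈ R) (hy : Transcendental k y)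
    (x : K) : ∃ c ∈ R, c ≠ 0 ∧ c * x ∈ R := by
  have halg := hy.isAlgebraic_adjoin htr
  obtain ⟨c, hc, hint⟩ := (halg.isAlgebraic x).exists_integral_multiple
  have hle : ∀ a ∈ Algebra.adjoin k {y}, a ∈ R := fun a ha => by
    refine Algebra.adjoin_induction (fun x hx => ?_) (algebraMap_mem_of_finite hR)
      (fun _ _ _ _ => R.add_mem) (fun _ _ _ _ => R.mul_mem) ha
    rw [Set.mem_singleton_iff.1 hx]
    exact hyR
  refine ⟨c, hle _ c.2, by simpa using hc, ?_⟩
  let f : Algebra.adjoin k {y} →+* R := Subring.inclusion (S := (Algebra.adjoin k {y}).toSubring) hle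
  exact hR _ (hint.map_of_comp_eq f (RingHom.id K) (by ext; rfl))

/-- An integrally closed subring of a global function field that contains a transcendental element
contains a separating element. -/
theorem exists_separating_mem (hfg : (⊤ : IntermediateField k K).FG) (htr : Algebra.trdeg k K = 1)
    (hR : ∀ x : K, IsIntegral R x → x ∈ R) (h : ∃ x ∈ R, Transcendental k x) :
    ∃ z ∈ R, Transcendental k z ∧ Algebra.IsSeparable k⟮z⟯ K := by
  obtain ⟨p, hp⟩ := CharP.exists k
  have : Fact p.Prime := ⟨CharP.char_is_prime k p⟩
  obtain ⟨z, hz, hzt, hsep⟩ := exists_transcendental_forall_isSeparable (p := p) hfg htr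
    (s := (R : Set K)) h
  refine ⟨z, hz, hzt, ⟨fun x => ?_⟩⟩
  obtain ⟨c, hc, hc0, hcx⟩ := exists_mul_mem_of_transcendental htr hR hz hzt x
  -- z is separating only for members of R at first; x is a quotient of two of them.
  have h1 : c⁻¹ * (c * x) ∈ separableClosure k⟮z⟯ K :=
    mul_mem (inv_mem (hsep c hc)) (hsep _ hcx)
  rwa [inv_mul_cancel_left₀ hc0] at h1

/-- A is the integral closure of k[z] for a separating z in R. Taking z inside R is what gives A ⊆
R. -/
theorem FunctionField.reduction_large
    (hfg : (⊤ : IntermediateField k K).FG) (htr : Algebra.trdeg k K = 1)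
    (S : Set (Place K)) (hSfin : S.Finite)
    (hSarch : ∀ v : Place K, v.IsArchimedean → v ∈ S)
    (d : ℕ) (W : Set (Matrix.GeneralLinearGroup (Fin d) (SIntegers S hSarch))) (hW : W.Finite)
    (B : ℕ → Set (Matrix.GeneralLinearGroup (Fin d) (SIntegers S hSarch)))
    (α : ℝ) (hα : 0 < α)
    (hBW : ∀ n : ℕ, 1 ≤ n → B n ⊆ W ^ n)
    (hBcard : ∀ n : ℕ, 1 ≤ n → Real.exp (α * n) ≤ ((B n).ncard : ℝ)) :
    (∀ n : ℕ, (primesInInterval (SIntegers S hSarch)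
        (Real.exp (3 * α * n)) (Real.exp (4 * α * n))).Finite) ∧
    (∀ᶠ n : ℕ in atTop, (primesInInterval (SIntegers S hSarch)
        (Real.exp (3 * α * n)) (Real.exp (4 * α * n))).Nonempty) ∧
    Tendsto (fun n : ℕ =>
      (({P ∈ primesInInterval (SIntegers S hSarch)
            (Real.exp (3 * α * n)) (Real.exp (4 * α * n)) |
          (primeNorm P : ℝ) ^ (1 / 4 : ℝ) ≤ ((reductionMod d P '' B n).ncard : ℝ)}.ncard : ℕ) : ℝ) /
        ((primesInInterval (SIntegers S hSarch)
            (Real.exp (3 * α * n)) (Real.exp (4 * α * n))).ncard : ℝ))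
      atTop (𝓝 1) := by
  classical
  have hR : ∀ x : K, IsIntegral (SIntegers S hSarch) x → x ∈ SIntegers S hSarch := fun x hx =>
    SIntegers.mem_of_isIntegral (fun o => o.2) hx
  obtain ⟨z, hz, hzt, hsep⟩ := exists_separating_mem hfg htr hR
    (exists_transcendental_of_growth (k := k) hW hα hBW hBcard)
  have hfd := hzt.finiteDimensional_adjoin hfg htr
  let := Fintype.ofFinite k
  let : Algebra k[X] K := (aeval z).toAlgebra
  have halg : ∀ q : k[X], algebraMap k[X] K q = aeval z q := fun q => rfl
  have : IsScalarTower k k[X] K := .of_algebraMap_eq fun c => by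
    rw [halg, algebraMap_eq, aeval_C]
  have hzX : algebraMap k[X] K X = z := by rw [halg, aeval_X]
  rw [← hzX] at hzt hsep hfd
  obtain ⟨h1, h2, h3, h4⟩ := integralClosure_polynomial_properties k K hzt
  let b := Module.Free.chooseBasis k[X] (integralClosure k[X] K)
  have := hasFiniteQuotients_of_basis b
  have := infinite_of_basis b
  refine reduction_large_of_overring (equidistributedIdeals_of_basis b)
    (IdealSize.ofBasis cardPowDegree b fun a ha => (cardQuot_span_eq_cardPowDegree b ha).le)
    (fun a => SIntegers.mem_of_isIntegral (O := k[X]) (fun q => ?_) a.2)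
    (finite_nonintegralPrimes_SIntegers hSfin) d W hW B α hα hBW hBcard
  rw [halg, aeval_eq_sum_range]
  refine Subring.sum_mem _ fun i _ => ?_
  rw [Algebra.smul_def]
  exact Subring.mul_mem _ (algebraMap_mem_of_finite hR _) (Subring.pow_mem _ hz i)

end FunctionField

theorem mainTheorem12 {K : Type*} [Field K] (hK : IsGlobalField K)
    (S : Set (Place K)) (hSfin : S.Finite) (hSne : S.Nonempty)
    (hSarch : ∀ v : Place K, v.IsArchimedean → v ∈ S)
    (d : ℕ) (W : Set (Matrix.GeneralLinearGroup (Fin d) (SIntegers S hSarch))) (hW : W.Finite)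
    (B : ℕ → Set (Matrix.GeneralLinearGroup (Fin d) (SIntegers S hSarch)))
    (α : ℝ) (hα : 0 < α)
    (hBW : ∀ n : ℕ, 1 ≤ n → B n ⊆ W ^ n)
    (hBcard : ∀ n : ℕ, 1 ≤ n → Real.exp (α * n) ≤ ((B n).ncard : ℝ)) :
    (∀ n : ℕ, (primesInInterval (SIntegers S hSarch)
        (Real.exp (3 * α * n)) (Real.exp (4 * α * n))).Finite) ∧
    (∀ᶠ n : ℕ in atTop, (primesInInterval (SIntegers S hSarch)
        (Real.exp (3 * α * n)) (Real.exp (4 * α * n))).Nonempty) ∧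
    Tendsto (fun n : ℕ =>
      (({P ∈ primesInInterval (SIntegers S hSarch)
            (Real.exp (3 * α * n)) (Real.exp (4 * α * n)) |
          (primeNorm P : ℝ) ^ (1 / 4 : ℝ) ≤ ((reductionMod d P '' B n).ncard : ℝ)}.ncard : ℕ) : ℝ) /
        ((primesInInterval (SIntegers S hSarch)
            (Real.exp (3 * α * n)) (Real.exp (4 * α * n))).ncard : ℝ))
      atTop (𝓝 1) := by
  rcases hK with hK | ⟨k, hk, hfg, htr⟩
  · exact NumberField.reduction_large S hSfin hSarch d W hW B α hα hBW hBcard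
  · exact FunctionField.reduction_large hfg htr S hSfin hSarch d W hW B α hα hBW hBcard
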